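/- All algebras are over $\mathbb{Q}$. A bi-Hamiltonian algebra is a vector space with three bilinear operations $\{\cdot,\cdot\}_1,\{\cdot,\cdot\}_2,\star$ such that $\{\cdot,\cdot\}_1$ and $\{\cdot,\cdot\}_2$ are skew-symmetric and every linear combination of them satisfies the Jacobi identity, $\star$ is commutative and associative (no unit is required), and $\{a,b\star c\}_i=\{a,b\}_i\star c+b\star\{a,c\}_i$ for $i=1,2$. For a finite set $I$, let $\mathsf{P}_2(I)$ be the space of multilinear elements of the free bi-Hamiltonian algebra generated by $I$, i.e. the span of the monomials in which each generator occurs exactly once; this is the component of the bi-Hamiltonian operad at $I$. Write $\mathsf{P}_2(n)=\mathsf{P}_2([n])$, where $[n]=\{1,\dots,n\}$. For a non-empty finite ordered set $A=\{a_1<\dots<a_m\}$ define recursively a set $\mathfrak{B}(A)=\mathfrak{B}_{\mathrm{Lie}_2}(A)$ of formal monomials in the two brackets: $\mathfrak{B}(\{a_1\})=\{a_1\}$, and for $m>1$ a monomial $b$ belongs to $\mathfrak{B}(A)$ if and only if one of the following holds: 1. $b=\{a_i,b'\}_1$ with $i<m$ and $b'\in\mathfrak{B}(A\setminus\{a_i\})$;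 2. $b=\{b_1,b_2\}_2$ with $b_1\in\mathfrak{B}(A_1)$ and $b_2\in\mathfrak{B}(A_2)$ for some $A_1\sqcup A_2=A$ with $a_m\in A_2$, where $b_1$ is either a single generator or of the form $\{s,t\}_1$. **Theorem.** Let $n\ge 1$. The monomials $c_1\star\cdots\star c_k$, where $[n]=A_1\sqcup\dots\sqcup A_k$ runs over all partitions of $[n]$ into non-empty blocks, numbered so that $\max A_1\le\dots\le\max A_k$, and $c_j\in\mathfrak{B}(A_j)$ for every $j$, form a basis of $\mathsf{P}_2(n)$ (different choices of the partition and of the $c_j$ giving different basis elements). Moreover, $$\dim \mathsf{P}_2(n)=(n+1)^{n-1}.$$ -/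

import Mathlib

namespace BiHam

/-- Formal (nonassociative) monomials in the generators `gen i`, `i : I`, built with the three
binary operations `{·,·}₁`, `{·,·}₂` and `⋆`. -/
inductive Mon (I : Type*) : Type _
  | gen (i : I) : Mon I
  | br₁ (s t : Mon I) : Mon I
  | br₂ (s t : Mon I) : Mon I
  | star (s t : Mon I) : Mon I

/-- The multiset of generators occurring in a monomial, counted with multiplicity. -/
def Mon.leaves {I : Type*} : Mon I → Multiset I
  | .gen i => {i}
  | .br₁ s t => s.leaves + t.leaves
  | .br₂ s t => s.leaves + t.leaves
  | .star s t => s.leaves + t.leaves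

/-- The free `ℚ`-algebra over `I` with three arbitrary bilinear operations: its linear basis
consists of all formal monomials. -/
abbrev FreeMagmatic (I : Type*) : Type _ := Mon I →₀ ℚ

section Operations

variable {I : Type*}

/-- Bilinear extension of a binary operation on monomials. -/
noncomputable def extendOp (f : Mon I → Mon I → Mon I) :
    FreeMagmatic I →ₗ[ℚ] FreeMagmatic I →ₗ[ℚ] FreeMagmatic I :=
  Finsupp.linearCombination ℚ fun s => Finsupp.lmapDomain ℚ ℚ (f s)

/-- The operation `{·,·}₁`. -/
noncomputable def bracket₁ : FreeMagmatic I →ₗ[ℚ] FreeMagmatic I →ₗ[ℚ] FreeMagmatic I :=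
  extendOp Mon.br₁

/-- The operation `{·,·}₂`. -/
noncomputable def bracket₂ : FreeMagmatic I →ₗ[ℚ] FreeMagmatic I →ₗ[ℚ] FreeMagmatic I :=
  extendOp Mon.br₂

/-- The operation `⋆`. -/
noncomputable def mul : FreeMagmatic I →ₗ[ℚ] FreeMagmatic I →ₗ[ℚ] FreeMagmatic I :=
  extendOp Mon.star

/-- The defining identities of bi-Hamiltonian algebras, each written as an element that has to
vanish: `{·,·}₁` and `{·,·}₂` are compatible Lie brackets, `⋆` is commutative and associative, and
both brackets are derivations of `⋆`. -/
inductive IsRelator : FreeMagmatic I → Prop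
  | skew₁ (a b : FreeMagmatic I) : IsRelator (bracket₁ a b + bracket₁ b a)
  | skew₂ (a b : FreeMagmatic I) : IsRelator (bracket₂ a b + bracket₂ b a)
  | comm (a b : FreeMagmatic I) : IsRelator (mul a b - mul b a)
  | assoc (a b c : FreeMagmatic I) : IsRelator (mul (mul a b) c - mul a (mul b c))
  | jacobi₁ (a b c : FreeMagmatic I) : IsRelator
      (bracket₁ a (bracket₁ b c) + bracket₁ b (bracket₁ c a) + bracket₁ c (bracket₁ a b))
  | jacobi₂ (a b c : FreeMagmatic I) : IsRelator
      (bracket₂ a (bracket₂ b c) + bracket₂ b (bracket₂ c a) + bracket₂ c (bracket₂ a b))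
  | sixTerm (a b c : FreeMagmatic I) : IsRelator
      (bracket₂ a (bracket₁ b c) + bracket₂ b (bracket₁ c a) + bracket₂ c (bracket₁ a b)
        + bracket₁ a (bracket₂ b c) + bracket₁ b (bracket₂ c a) + bracket₁ c (bracket₂ a b))
  | leibniz₁ (a b c : FreeMagmatic I) : IsRelator
      (bracket₁ a (mul b c) - (mul (bracket₁ a b) c + mul b (bracket₁ a c)))
  | leibniz₂ (a b c : FreeMagmatic I) : IsRelator
      (bracket₂ a (mul b c) - (mul (bracket₂ a b) c + mul b (bracket₂ a c)))

/-- Two-sided ideals for all three operations. -/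
structure IsIdeal (J : Submodule ℚ (FreeMagmatic I)) : Prop where
  bracket₁_right : ∀ x, ∀ y ∈ J, bracket₁ x y ∈ J
  bracket₁_left : ∀ x ∈ J, ∀ y, bracket₁ x y ∈ J
  bracket₂_right : ∀ x, ∀ y ∈ J, bracket₂ x y ∈ J
  bracket₂_left : ∀ x ∈ J, ∀ y, bracket₂ x y ∈ J
  mul_right : ∀ x, ∀ y ∈ J, mul x y ∈ J
  mul_left : ∀ x ∈ J, ∀ y, mul x y ∈ J

end Operations

/-- The smallest ideal that contains all relators. -/
noncomputable def relIdeal (I : Type*) : Submodule ℚ (FreeMagmatic I) :=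
  sInf {J | IsIdeal J ∧ ∀ x, IsRelator x → x ∈ J}

/-- The (non-unital) free bi-Hamiltonian algebra over `ℚ` generated by `I`. -/
abbrev FreeBiHam (I : Type*) : Type _ := FreeMagmatic I ⧸ relIdeal I

/-- The value of a formal monomial in the free bi-Hamiltonian algebra. -/
noncomputable def Mon.eval {I : Type*} (m : Mon I) : FreeBiHam I :=
  (relIdeal I).mkQ (Finsupp.single m 1)

/-- The component `P₂(I)` of the bi-Hamiltonian operad at a finite set `I`: the space of multilinear
elements of the free bi-Hamiltonian algebra generated by `I`, that is, the span of the monomials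
in which every generator occurs exactly once. -/
noncomputable def P₂ (I : Type*) [Fintype I] : Submodule ℚ (FreeBiHam I) :=
  Submodule.span ℚ (Mon.eval '' {m : Mon I | m.leaves = (Finset.univ : Finset I).val})

/-- `LieBasis A b` says that the monomial `b` in the two brackets belongs to the family
`𝔅_{Lie₂}(A)` attached to the finite ordered set `A`. In the constructors `m` is the maximum of
the underlying set. In the last one, when `b₁ = {s, t}₁` lies in the family of `A₁`, its arguments
`s` and `t` automatically lie in the families of subsets of `A₁`. -/
inductive LieBasis {I : Type*} [LinearOrder I] : Finset I → Mon I → Prop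
  | gen (i : I) : LieBasis {i} (.gen i)
  | br₁ {A : Finset I} {m i : I} {b' : Mon I}
      (hm : IsGreatest (A : Set I) m) (hi : i ∈ A) (him : i < m)
      (hb' : LieBasis (A.erase i) b') :
      LieBasis A (.br₁ (.gen i) b')
  | br₂ {A A₁ A₂ : Finset I} {m : I} {b₁ b₂ : Mon I}
      (hdisj : Disjoint A₁ A₂) (hunion : A₁ ∪ A₂ = A)
      (hm : IsGreatest (A : Set I) m) (hmA₂ : m ∈ A₂)
      (hb₁ : LieBasis A₁ b₁) (hb₂ : LieBasis A₂ b₂)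
      (hform : (∃ i, b₁ = .gen i) ∨ ∃ s t, b₁ = .br₁ s t) :
      LieBasis A (.br₂ b₁ b₂)

/-- The product `c₀ ⋆ (c₁ ⋆ (⋯ ⋆ c_k))` of a non-empty sequence of monomials. -/
def starProd {I : Type*} : {k : ℕ} → (Fin (k + 1) → Mon I) → Mon I
  | 0, c => c 0
  | _ + 1, c => .star (c 0) (starProd (Fin.tail c))

/-- The set `𝔅_{P₂}(n)` of formal monomials `c₀ ⋆ ⋯ ⋆ c_k` with `c_j ∈ 𝔅_{Lie₂}(A_j)`, where
`[n] = A₀ ⊔ ⋯ ⊔ A_k` is a set partition with `max A₀ ≤ ⋯ ≤ max A_k`. The blocks are non-empty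
because `𝔅_{Lie₂}(∅)` is empty, and a formal monomial of this kind determines the partition and
the factors `c_j`. -/
def P₂Basis (n : ℕ) : Set (Mon (Fin n)) :=
  {b | ∃ (k : ℕ) (A : Fin (k + 1) → Finset (Fin n)) (c : Fin (k + 1) → Mon (Fin n)),
    Pairwise (fun i j => Disjoint (A i) (A j)) ∧
    Finset.univ.biUnion A = Finset.univ ∧
    Monotone (fun j => (A j).max) ∧
    (∀ j, LieBasis (A j) (c j)) ∧
    b = starProd c}

end BiHam

/-!
The monomials `c₁ ⋆ ⋯ ⋆ c_k` span the multilinear component because every multilinear monomial can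
be rewritten in terms of them, they are linearly independent because of a triangular pairing with
graphs, and their number is found with Abel's binomial identity.

*Spanning.* Let `V(A)` be the span of the values of `𝔅(A)`. For disjoint `A` and `B` with
`max (A ∪ B) ∈ B`, both brackets map `V(A) × V(B)` into `V(A ∪ B)`, by induction on `|A|`
(`qbr_mem_lieSpan_of_isGreatest`). When the left argument is itself a bracket, the Jacobi identity
or, for different brackets, the six-term identity that expresses compatibility, replaces
`{{a, a'}, b}` by terms in which `a` and `a'` act on `b` one after the other; the six-term identity
moreover produces `{{a, a'}₁, b}₂`, so second brackets are treated before first ones. The brackets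
that are not rewritten have the shape allowed in `𝔅(A ∪ B)`. The Leibniz rule then moves brackets
inside products, and commutativity and associativity sort the factors by their maxima
(`Mon.eval_mem_productSpan`, `P₂_eq_span`).

*Independence.* Let `E` be a finite directed graph on the generators whose edges have one of two
colours. On the vector space with basis `e_A`, for `A` a multiset of generators, put
`e_A ⋆ e_B = e_(A + B)` if no edge of `E` joins `A` and `B`, and `0` otherwise; and let the bracket
of colour `c` of `e_A` and `e_B` be `± e_(A + B)` if exactly one edge, counted with multiplicity,
joins `A` and `B` and this edge has colour `c`, the sign being given by its direction, and `0`
otherwise. This is a bi-Hamiltonian algebra (`bracketCoeff_jacobi`, `bracketCoeff_leibniz`,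
`mulCoeff_assoc`), so `E` defines a linear form on the free bi-Hamiltonian algebra, the sum of the
coordinates of the image. Its value at a multilinear monomial is nonzero exactly if `E` can be
taken apart along the monomial, that is, if each bracket cuts exactly one edge, of the right
colour, and each product none (`Mon.pairing_ne_zero_iff`).

Attach to `b ∈ 𝔅(A)` a coloured tree on `A`: the left arguments `i₁, …, i_r` of the first brackets
on the right spine of `b` give a path `i₁, …, i_r, max A` of edges of the first colour, likewise
for the blocks that second brackets split off, and a second bracket gives an edge of the second
colour between the leftmost generators of its arguments (`Mon.edges`). The tree of `b` can be taken
apart along `b` (`LieBasis.cut_edges`). If it can also be taken apart along another member `b'` of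
`𝔅(A)`, the key of `b'`, a list of natural numbers, is larger than the key of `b`
(`triangularBelow`). Indeed, the first brackets on the right spine of `b'` must cut the path of `b`
from its starting point, so that the path of `b` is part of the one of `b'`
(`LieBasis.sublist_ones`); if the paths agree, then connectedness shows that the second brackets at
the root of `b'` split off at least the generators that those of `b` split off; if these sets agree
too, the blocks that are split off are compared one by one, the last one first
(`chain_eq_or_lexLT`), and finally the remaining parts. For products, the partition is recovered
from the connected components (`IsPartitionList.triangular`), and
`linearIndependent_partitionMonomials` follows.

*Counting.* Removing the left argument of a bracket at the root, or the factor of a product that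
contains the maximum, shows that the numbers of Lie monomials on `m` letters, of those that are
generators or first brackets, and of products on `m` letters satisfy recursions, which Abel's identity (`abel_identity`) solves by `m ^ (m - 1)`, `(m - 1) ^ (m - 1)`
and `(m + 1) ^ (m - 1)` (`exists_finset_lieBasis`, `exists_finset_isPartitionList`).
-/

set_option linter.unusedSectionVars false

namespace BiHam

/-! ### Monomials and their two-coloured graphs -/

section Combinatorics

variable {I : Type*} [LinearOrder I]

/-- The set of generators that occur in a monomial. -/
def Mon.supp : Mon I → Finset I
  | .gen i => {i}
  | .br₁ s t => s.supp ∪ t.supp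
  | .br₂ s t => s.supp ∪ t.supp
  | .star s t => s.supp ∪ t.supp

/-- The leftmost generator of a monomial. -/
def Mon.first : Mon I → I
  | .gen i => i
  | .br₁ s _ => s.first
  | .br₂ s _ => s.first
  | .star s _ => s.first

/-- The rightmost generator of a monomial; for a member of `𝔅(A)` it is the maximum of `A`. -/
def Mon.tip : Mon I → I
  | .gen i => i
  | .br₁ _ t => t.tip
  | .br₂ _ t => t.tip
  | .star _ t => t.tip

/-- The left arguments of the first brackets met on the way from the root of a monomial to its
rightmost generator; in a member of `𝔅(A)` these arguments are single generators. -/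
def Mon.ones : Mon I → List I
  | .gen _ => []
  | .br₁ s t => s.first :: t.ones
  | .br₂ _ t => t.ones
  | .star _ t => t.ones

/-- The first entry of `b.ones`, or `b.tip` if that list is empty. -/
def Mon.next : Mon I → I
  | .gen i => i
  | .br₁ s _ => s.first
  | .br₂ _ t => t.next
  | .star _ t => t.next

/-- The arguments `u₁, …, u_r` of the second brackets at the root of
`{u₁, {u₂, … {u_r, b'}₂ …}₂}₂`, where `b'` is not itself a second bracket. -/
def Mon.chain : Mon I → List (Mon I)
  | .br₂ u t => u :: t.chain
  | _ => []

/-- What remains of a monomial when the second brackets at its root are stripped off. -/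
def Mon.body : Mon I → Mon I
  | .br₂ _ t => t.body
  | b => b

/-- The generators that occur in a list of monomials. -/
def csupp : List (Mon I) → Finset I
  | [] => ∅
  | u :: W => u.supp ∪ csupp W

/-- The two-coloured graph attached to a monomial, as a finite set of directed edges `(c, i, j)`;
the colour `c` is `false` for the first bracket and `true` for the second one. A first bracket
`{i, b}₁` adds an edge from `i` to the left argument of the next first bracket on the way to the
rightmost generator, or to that generator; a second bracket joins the leftmost generators of its
arguments. For a member of `𝔅(A)` the graph is a tree on `A`. -/
def Mon.edges : Mon I → Finset (Bool × I × I)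
  | .gen _ => ∅
  | .br₁ s t => insert (false, s.first, t.next) (s.edges ∪ t.edges)
  | .br₂ s t => insert (true, s.first, t.first) (s.edges ∪ t.edges)
  | .star s t => s.edges ∪ t.edges

/-- The edge `e` has one end in `A` and the other one in `B`. -/
def Crosses (e : Bool × I × I) (A B : Finset I) : Prop :=
  (e.2.1 ∈ A ∧ e.2.2 ∈ B) ∨ (e.2.1 ∈ B ∧ e.2.2 ∈ A)

/-- Exactly one edge of `E` runs between `A` and `B`, and it has the colour `c`. -/
def CutBy (E : Finset (Bool × I × I)) (c : Bool) (A B : Finset I) : Prop :=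
  ∃ e ∈ E, e.1 = c ∧ Crosses e A B ∧ ∀ e' ∈ E, Crosses e' A B → e' = e

/-- The graph `E` can be taken apart along the monomial: for every bracket in it, exactly one edge
of `E` runs between the generators of the two arguments, and it has the colour of the bracket; for
every product, there is no such edge. -/
def Mon.Cut (E : Finset (Bool × I × I)) : Mon I → Prop
  | .gen _ => True
  | .br₁ s t => CutBy E false s.supp t.supp ∧ s.Cut E ∧ t.Cut E
  | .br₂ s t => CutBy E true s.supp t.supp ∧ s.Cut E ∧ t.Cut E
  | .star s t => (∀ e ∈ E, ¬ Crosses e s.supp t.supp) ∧ s.Cut E ∧ t.Cut E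

/-- The monomial is a single generator or a first bracket. -/
def Mon.IsBlock (b : Mon I) : Prop := (∃ i, b = .gen i) ∨ ∃ s t, b = .br₁ s t

/-! ### Shape of the monomials in the Lie families -/

theorem LieBasis.supp_eq {A : Finset I} {b : Mon I} (h : LieBasis A b) : b.supp = A := by
  induction h with
  | gen i => rfl
  | br₁ hm hi him hb' ih =>
    simp only [Mon.supp, ih]
    grind
  | br₂ hd hu hm hm2 h1 h2 hf ih1 ih2 => simp only [Mon.supp, ih1, ih2, hu]

theorem LieBasis.isGreatest_tip {A : Finset I} {b : Mon I} (h : LieBasis A b) :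
    IsGreatest (A : Set I) b.tip := by
  induction h with
  | gen i => simp [Mon.tip]
  | @br₁ A m i b' hm hi him hb' ih =>
    simp only [Mon.tip]
    have h1 : m ∈ A.erase i := by
      have := hm.1
      simp at this
      grind
    have : b'.tip = m := le_antisymm (hm.2 (Finset.erase_subset _ _ ih.1)) (ih.2 h1)
    rw [this]; exact hm
  | @br₂ A A₁ A₂ m b₁ b₂ hd hu hm hm2 h1 h2 hf ih1 ih2 =>
    simp only [Mon.tip]
    have h1 : A₂ ⊆ A := by grind
    have : b₂.tip = m := le_antisymm (hm.2 (h1 ih2.1)) (ih2.2 hm2)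
    rw [this]; exact hm

theorem Mon.first_mem (b : Mon I) : b.first ∈ b.supp := by
  induction b <;> simp_all [Mon.first, Mon.supp]

theorem Mon.tip_mem (b : Mon I) : b.tip ∈ b.supp := by
  induction b <;> simp_all [Mon.tip, Mon.supp]

theorem Mon.next_mem (b : Mon I) : b.next ∈ b.supp := by
  induction b with
  | br₁ s t => simp [Mon.next, Mon.supp, Mon.first_mem]
  | _ => simp_all [Mon.next, Mon.supp]

theorem Mon.mem_supp_of_mem_ones {b : Mon I} {i : I} (h : i ∈ b.ones) : i ∈ b.supp := by
  induction b with
  | br₁ s t ihs iht =>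
    simp only [Mon.ones, List.mem_cons] at h
    have := s.first_mem
    simp only [Mon.supp, Finset.mem_union]
    grind
  | _ => simp_all [Mon.ones, Mon.supp]

theorem Mon.mem_supp_of_mem_edges {b : Mon I} {e : Bool × I × I} (h : e ∈ b.edges) :
    e.2.1 ∈ b.supp ∧ e.2.2 ∈ b.supp := by
  induction b with
  | gen i => simp [Mon.edges] at h
  | br₁ s t ihs iht =>
    have := s.first_mem; have := t.next_mem
    simp only [Mon.edges, Finset.mem_insert, Finset.mem_union] at h
    simp only [Mon.supp, Finset.mem_union]
    grind
  | br₂ s t ihs iht =>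
    have := s.first_mem; have := t.first_mem
    simp only [Mon.edges, Finset.mem_insert, Finset.mem_union] at h
    simp only [Mon.supp, Finset.mem_union]
    grind
  | star s t ihs iht =>
    simp only [Mon.edges, Finset.mem_union] at h
    simp only [Mon.supp, Finset.mem_union]
    grind

theorem Mon.ones_append_tip (b : Mon I) : ∃ l, b.ones ++ [b.tip] = b.next :: l := by
  induction b with
  | gen i => exact ⟨[], rfl⟩
  | br₁ s t _ _ => exact ⟨t.ones ++ [t.tip], rfl⟩
  | br₂ s t _ ih => exact ih
  | star s t _ ih => exact ih

theorem Mon.supp_eq_csupp_union (b : Mon I) : b.supp = csupp b.chain ∪ b.body.supp := by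
  induction b <;> simp_all [Mon.chain, Mon.body, csupp, Mon.supp, Finset.union_assoc]

/-- Inversion of the constructor `LieBasis.br₁`. -/
theorem LieBasis.inv_br₁ {A : Finset I} {s t : Mon I} (h : LieBasis A (.br₁ s t)) :
    ∃ i, s = .gen i ∧ i ∈ A ∧ i < t.tip ∧ LieBasis (A.erase i) t := by
  have ht := h.isGreatest_tip
  cases h with
  | @br₁ _ m i _ hm hi him hb =>
    have : m = t.tip := hm.unique ht
    exact ⟨i, rfl, hi, this ▸ him, hb⟩

/-- Inversion of the constructor `LieBasis.br₂`. -/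
theorem LieBasis.inv_br₂ {A : Finset I} {s t : Mon I} (h : LieBasis A (.br₂ s t)) :
    Disjoint s.supp t.supp ∧ s.supp ∪ t.supp = A ∧ LieBasis s.supp s ∧ LieBasis t.supp t ∧
      s.IsBlock := by
  cases h with
  | br₂ hd hu hm hm2 h1 h2 hf =>
    rw [h1.supp_eq, h2.supp_eq]
    exact ⟨hd, hu, h1, h2, hf⟩

theorem LieBasis.self {A : Finset I} {b : Mon I} (h : LieBasis A b) : LieBasis b.supp b :=
  h.supp_eq ▸ h

theorem LieBasis.nodup {A : Finset I} {b : Mon I} (h : LieBasis A b) :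
    (b.ones ++ [b.tip]).Nodup := by
  induction h with
  | gen i => simp [Mon.ones]
  | @br₁ A m i b' hm hi him hb' ih =>
    simp only [Mon.ones, Mon.tip, List.cons_append, List.nodup_cons]
    refine ⟨fun hmem => ?_, ih⟩
    have h1 : i ∈ b'.supp := by
      rcases List.mem_append.1 hmem with h | h
      · exact Mon.mem_supp_of_mem_ones h
      · rw [List.mem_singleton] at h
        rw [show i = b'.tip from h]
        exact b'.tip_mem
    rw [hb'.supp_eq] at h1
    simp at h1
  | br₂ hd hu hm hm2 h1 h2 hf ih1 ih2 => exact ih2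

/-- The edges of the first colour contain the path through `b.ones` to `b.tip`. -/
theorem Mon.isChain_edges (b : Mon I) :
    (b.ones ++ [b.tip]).IsChain fun a a' => (false, a, a') ∈ b.edges := by
  induction b with
  | gen i => simp [Mon.ones]
  | br₁ s t ihs iht =>
    obtain ⟨l, hl⟩ := t.ones_append_tip
    simp only [Mon.ones, Mon.tip, List.cons_append, hl] at iht ⊢
    refine List.IsChain.cons_cons (by simp [Mon.edges]) (iht.imp fun a a' h => ?_)
    simp [Mon.edges, h]
  | br₂ s t ihs iht =>
    exact iht.imp fun a a' h => by simp [Mon.edges, h]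
  | star s t ihs iht =>
    exact iht.imp fun a a' h => by simp [Mon.edges, h]

theorem LieBasis.body {A : Finset I} {b : Mon I} (h : LieBasis A b) :
    LieBasis b.body.supp b.body ∧ b.body.IsBlock ∧ Disjoint (csupp b.chain) b.body.supp := by
  induction h with
  | gen i => exact ⟨.gen i, .inl ⟨i, rfl⟩, by simp [Mon.chain, csupp]⟩
  | br₁ hm hi him hb' ih =>
    exact ⟨(LieBasis.br₁ hm hi him hb').self, .inr ⟨_, _, rfl⟩, by simp [Mon.chain, csupp]⟩
  | @br₂ A A₁ A₂ m b₁ b₂ hd hu hm hm2 h1 h2 hf ih1 ih2 =>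
    refine ⟨ih2.1, ih2.2.1, ?_⟩
    simp only [Mon.chain, csupp, Mon.body, Finset.disjoint_union_left]
    refine ⟨?_, ih2.2.2⟩
    rw [h1.supp_eq]
    refine hd.mono_right ?_
    rw [← h2.supp_eq, b₂.supp_eq_csupp_union]
    exact Finset.subset_union_right

/-! ### Taking graphs apart along monomials -/

theorem Crosses.symm {e : Bool × I × I} {A B : Finset I} (h : Crosses e A B) : Crosses e B A := by
  unfold Crosses at *; tauto

theorem Crosses.mono {e : Bool × I × I} {A B A' B' : Finset I} (h : Crosses e A B)
    (hA : A ⊆ A') (hB : B ⊆ B') : Crosses e A' B' := by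
  unfold Crosses at *
  rcases h with h | h
  · exact .inl ⟨hA h.1, hB h.2⟩
  · exact .inr ⟨hB h.1, hA h.2⟩

theorem CutBy.congr {E E' : Finset (Bool × I × I)} {c : Bool} {A B : Finset I}
    (h : ∀ e : Bool × I × I, e.2.1 ∈ A ∪ B → e.2.2 ∈ A ∪ B → (e ∈ E ↔ e ∈ E'))
    (hc : CutBy E c A B) : CutBy E' c A B := by
  obtain ⟨e, he, hec, hx, hu⟩ := hc
  have key : ∀ e, Crosses e A B → (e ∈ E ↔ e ∈ E') := fun e hx => by
    refine h e ?_ ?_ <;> unfold Crosses at hx <;> grind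
  exact ⟨e, (key e hx).1 he, hec, hx, fun e' he' hx' => hu e' ((key e' hx').2 he') hx'⟩

theorem Mon.Cut.congr {E E' : Finset (Bool × I × I)} {b : Mon I}
    (h : ∀ e : Bool × I × I, e.2.1 ∈ b.supp → e.2.2 ∈ b.supp → (e ∈ E ↔ e ∈ E'))
    (hb : b.Cut E) : b.Cut E' := by
  induction b with
  | gen i => trivial
  | br₁ s t ihs iht =>
    simp only [Mon.supp] at h
    exact ⟨hb.1.congr h, ihs (fun e h1 h2 => h e (Finset.mem_union_left _ h1)
      (Finset.mem_union_left _ h2)) hb.2.1, iht (fun e h1 h2 => h e (Finset.mem_union_right _ h1)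
      (Finset.mem_union_right _ h2)) hb.2.2⟩
  | br₂ s t ihs iht =>
    simp only [Mon.supp] at h
    exact ⟨hb.1.congr h, ihs (fun e h1 h2 => h e (Finset.mem_union_left _ h1)
      (Finset.mem_union_left _ h2)) hb.2.1, iht (fun e h1 h2 => h e (Finset.mem_union_right _ h1)
      (Finset.mem_union_right _ h2)) hb.2.2⟩
  | star s t ihs iht =>
    simp only [Mon.supp] at h
    refine ⟨fun e he hx => hb.1 e ((h e ?_ ?_).2 he) hx,
      ihs (fun e h1 h2 => h e (Finset.mem_union_left _ h1)
      (Finset.mem_union_left _ h2)) hb.2.1, iht (fun e h1 h2 => h e (Finset.mem_union_right _ h1)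
      (Finset.mem_union_right _ h2)) hb.2.2⟩ <;> unfold Crosses at hx <;> grind

theorem Mon.Cut.body {E : Finset (Bool × I × I)} {b : Mon I} (h : b.Cut E) : b.body.Cut E := by
  induction b with
  | br₂ s t ihs iht => exact iht h.2.2
  | _ => exact h

/-- An edge of the graph of `s` or of `t` does not run between disjoint `s` and `t`. -/
theorem Mon.not_crosses_of_mem_edges {s t : Mon I} (hd : Disjoint s.supp t.supp)
    {e : Bool × I × I} (he : e ∈ s.edges ∪ t.edges) : ¬ Crosses e s.supp t.supp := by
  intro hx
  have hd' := Finset.disjoint_left.1 hd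
  rcases Finset.mem_union.1 he with h | h <;> have := Mon.mem_supp_of_mem_edges h <;>
    unfold Crosses at hx <;> grind

theorem Mon.edges_congr_left {s t : Mon I} (hd : Disjoint s.supp t.supp) {e x : Bool × I × I}
    (hx : Crosses x s.supp t.supp) (h1 : e.2.1 ∈ s.supp) (h2 : e.2.2 ∈ s.supp) :
    e ∈ s.edges ↔ e ∈ insert x (s.edges ∪ t.edges) := by
  have hd' := Finset.disjoint_left.1 hd
  have h3 : e ∈ t.edges → False := fun h => hd' h1 (Mon.mem_supp_of_mem_edges h).1
  have h4 : e ≠ x := by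
    rintro rfl
    unfold Crosses at hx
    grind
  simp only [Finset.mem_insert, Finset.mem_union]
  tauto

theorem Mon.edges_congr_right {s t : Mon I} (hd : Disjoint s.supp t.supp) {e x : Bool × I × I}
    (hx : Crosses x s.supp t.supp) (h1 : e.2.1 ∈ t.supp) (h2 : e.2.2 ∈ t.supp) :
    e ∈ t.edges ↔ e ∈ insert x (s.edges ∪ t.edges) := by
  rw [Finset.union_comm]
  exact Mon.edges_congr_left hd.symm hx.symm h1 h2

theorem LieBasis.disjoint_br₁ {A : Finset I} {s t : Mon I} (h : LieBasis A (.br₁ s t)) :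
    Disjoint s.supp t.supp := by
  obtain ⟨i, rfl, hi, -, ht⟩ := h.inv_br₁
  rw [ht.supp_eq]
  simp [Mon.supp]

/-- The graph of a member of `𝔅(A)` can be taken apart along that member. -/
theorem LieBasis.cut_edges {A : Finset I} {b : Mon I} (h : LieBasis A b) : b.Cut b.edges := by
  induction h with
  | gen i => trivial
  | @br₁ A m i b' hm hi him hb' ih =>
    have hd := (LieBasis.br₁ hm hi him hb').disjoint_br₁
    have hx : Crosses (false, (Mon.gen i).first, b'.next) (Mon.gen i).supp b'.supp :=
      .inl ⟨Mon.first_mem _, b'.next_mem⟩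
    refine ⟨⟨_, Finset.mem_insert_self _ _, rfl, hx, fun e' he' hx' => ?_⟩, trivial,
      ih.congr fun e h1 h2 => Mon.edges_congr_right hd hx h1 h2⟩
    rcases Finset.mem_insert.1 he' with h | h
    · exact h
    · exact absurd hx' (Mon.not_crosses_of_mem_edges hd h)
  | @br₂ A A₁ A₂ m b₁ b₂ hd hu hm hm2 h1 h2 hf ih1 ih2 =>
    rw [← h1.supp_eq, ← h2.supp_eq] at hd
    have hx : Crosses (true, b₁.first, b₂.first) b₁.supp b₂.supp :=
      .inl ⟨b₁.first_mem, b₂.first_mem⟩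
    refine ⟨⟨_, Finset.mem_insert_self _ _, rfl, hx, fun e' he' hx' => ?_⟩,
      ih1.congr fun e h1 h2 => Mon.edges_congr_left hd hx h1 h2,
      ih2.congr fun e h1 h2 => Mon.edges_congr_right hd hx h1 h2⟩
    rcases Finset.mem_insert.1 he' with h | h
    · exact h
    · exact absurd hx' (Mon.not_crosses_of_mem_edges hd h)

/-- A graph that can be taken apart along a member of `𝔅(A)` is connected on `A`. -/
theorem LieBasis.connected {A : Finset I} {b : Mon I} (h : LieBasis A b)
    {E : Finset (Bool × I × I)} (hb : b.Cut E) (Z : Finset I) {x y : I} (hx : x ∈ A) (hxZ : x ∈ Z)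
    (hy : y ∈ A) (hyZ : y ∉ Z) : ∃ e ∈ E, Crosses e (A ∩ Z) (A \ Z) := by
  have join : ∀ {c : Bool} {A₁ A₂ A : Finset I}, A₁ ⊆ A → A₂ ⊆ A → A ⊆ A₁ ∪ A₂ → CutBy E c A₁ A₂ →
      (∀ x y, x ∈ A₁ → x ∈ Z → y ∈ A₁ → y ∉ Z → ∃ e ∈ E, Crosses e (A₁ ∩ Z) (A₁ \ Z)) →
      (∀ x y, x ∈ A₂ → x ∈ Z → y ∈ A₂ → y ∉ Z → ∃ e ∈ E, Crosses e (A₂ ∩ Z) (A₂ \ Z)) →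
      ∀ x y, x ∈ A → x ∈ Z → y ∈ A → y ∉ Z → ∃ e ∈ E, Crosses e (A ∩ Z) (A \ Z) := by
    intro c A₁ A₂ A hs1 hs2 hs hc ih1 ih2 x y hx hxZ hy hyZ
    have m1 : (∃ e ∈ E, Crosses e (A₁ ∩ Z) (A₁ \ Z)) → ∃ e ∈ E, Crosses e (A ∩ Z) (A \ Z) :=
      fun ⟨e, he, hc⟩ => ⟨e, he, hc.mono (by grind) (by grind)⟩
    have m2 : (∃ e ∈ E, Crosses e (A₂ ∩ Z) (A₂ \ Z)) → ∃ e ∈ E, Crosses e (A ∩ Z) (A \ Z) :=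
      fun ⟨e, he, hc⟩ => ⟨e, he, hc.mono (by grind) (by grind)⟩
    obtain ⟨e, he, -, hce, -⟩ := hc
    by_cases h1 : ∃ x y, x ∈ A₁ ∧ x ∈ Z ∧ y ∈ A₁ ∧ y ∉ Z
    · obtain ⟨x, y, a, b, c, d⟩ := h1
      exact m1 (ih1 x y a b c d)
    by_cases h2 : ∃ x y, x ∈ A₂ ∧ x ∈ Z ∧ y ∈ A₂ ∧ y ∉ Z
    · obtain ⟨x, y, a, b, c, d⟩ := h2
      exact m2 (ih2 x y a b c d)
    refine ⟨e, he, ?_⟩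
    unfold Crosses at hce ⊢
    push Not at h1 h2
    have := hs hx
    have := hs hy
    simp only [Finset.mem_union, Finset.mem_inter, Finset.mem_sdiff] at *
    grind
  revert x y
  induction h with
  | gen i =>
    intro x y hx hxZ hy hyZ
    simp only [Finset.mem_singleton] at hx hy
    exact absurd (hx ▸ hxZ) (hy ▸ hyZ)
  | @br₁ A m i b' hm hi him hb' ih =>
    intro x y hx hxZ hy hyZ
    have hc := hb.1
    rw [hb'.supp_eq] at hc
    refine join (A := A) (by simpa [Mon.supp] using hi) (Finset.erase_subset _ _) ?_ hc ?_
      (fun x y a b c d => ih hb.2.2 a b c d) x y hx hxZ hy hyZ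
    · simp only [Mon.supp]; grind
    · simp only [Mon.supp]; grind
  | @br₂ A A₁ A₂ m b₁ b₂ hd hu hm hm2 h1 h2 hf ih1 ih2 =>
    intro x y hx hxZ hy hyZ
    have hc := hb.1
    rw [h1.supp_eq, h2.supp_eq] at hc
    exact join (by grind) (by grind) (by grind) hc
      (fun x y a b c d => ih1 hb.2.1 a b c d)
      (fun x y a b c d => ih2 hb.2.2 a b c d) x y hx hxZ hy hyZ

end Combinatorics

/-! ### Comparison of keys -/

section Order

variable {I : Type*} [LinearOrder I]

/-- The first difference between the two lists is at a position within both of them, and there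
the second list has the larger entry. In contrast to the lexicographic order, this relation is
preserved when the lists are prolonged by arbitrary lists. -/
def LexLT (k k' : List ℕ) : Prop :=
  ∃ (p : List ℕ) (x y : ℕ) (s s' : List ℕ), k = p ++ x :: s ∧ k' = p ++ y :: s' ∧ x < y

theorem LexLT.lt {k k' : List ℕ} (h : LexLT k k') : k < k' := by
  obtain ⟨p, x, y, s, s', rfl, rfl, hxy⟩ := h
  exact List.append_left_lt (List.cons_lt_cons_iff.2 (.inl hxy))

theorem LexLT.head {x y : ℕ} (h : x < y) (s s' : List ℕ) : LexLT (x :: s) (y :: s') :=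
  ⟨[], x, y, s, s', rfl, rfl, h⟩

theorem LexLT.append_right {k k' : List ℕ} (h : LexLT k k') (r r' : List ℕ) :
    LexLT (k ++ r) (k' ++ r') := by
  obtain ⟨p, x, y, s, s', rfl, rfl, hxy⟩ := h
  exact ⟨p, x, y, s ++ r, s' ++ r', by simp, by simp, hxy⟩

theorem LexLT.append_left {k k' : List ℕ} (h : LexLT k k') (r : List ℕ) :
    LexLT (r ++ k) (r ++ k') := by
  obtain ⟨p, x, y, s, s', rfl, rfl, hxy⟩ := h
  exact ⟨r ++ p, x, y, s, s', by simp, by simp, hxy⟩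

theorem LexLT.cons {k k' : List ℕ} (h : LexLT k k') (x : ℕ) : LexLT (x :: k) (x :: k') :=
  h.append_left [x]

/-! ### Paths of the first colour -/

/-- A path of edges of the first colour that ends in `m` lies on the side of `m` of any cut by an
edge of the second colour. -/
theorem forall_mem_of_isChain {E : Finset (Bool × I × I)} {A B : Finset I} (hc : CutBy E true A B)
    {m : I} (hm : m ∈ B) (l : List I) (hl : ∀ a ∈ l, a ∈ A ∪ B)
    (hp : (l ++ [m]).IsChain fun a a' => (false, a, a') ∈ E) : ∀ a ∈ l, a ∈ B := by
  obtain ⟨e, he, hec, hx, hu⟩ := hc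
  induction l with
  | nil => simp
  | cons b l ih =>
    have ih' := ih (fun a ha => hl a (List.mem_cons_of_mem _ ha)) hp.tail
    intro a ha
    rcases List.mem_cons.1 ha with rfl | ha
    · by_contra haB
      have haA : a ∈ A := by have := hl a (by simp); grind
      obtain ⟨c, l', hcl⟩ : ∃ c l', l ++ [m] = c :: l' := by
        cases l with
        | nil => exact ⟨m, [], rfl⟩
        | cons c l => exact ⟨c, l ++ [m], rfl⟩
      have hcB : c ∈ B := by
        have : c ∈ l ++ [m] := by simp [hcl]
        rcases List.mem_append.1 this with h | h
        · exact ih' c h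
        · rw [List.mem_singleton.1 h]; exact hm
      rw [List.cons_append, hcl] at hp
      have := hu _ (List.isChain_cons_cons.1 hp).1 (.inl ⟨haA, hcB⟩)
      rw [← this] at hec
      simp at hec
    · exact ih' a ha

/-- If a graph can be taken apart along a member `b` of `𝔅(A)`, the first brackets of `b` have to
cut the path of edges of the first colour to the maximum of `A` one vertex after the other. -/
theorem LieBasis.sublist_ones {A : Finset I} {b : Mon I} (h : LieBasis A b)
    {E : Finset (Bool × I × I)} (hb : b.Cut E) (l : List I) (hl : ∀ a ∈ l, a ∈ A)
    (hn : (l ++ [b.tip]).Nodup)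
    (hp : (l ++ [b.tip]).IsChain fun a a' => (false, a, a') ∈ E) : l.Sublist b.ones := by
  induction h generalizing l with
  | gen i =>
    cases l with
    | nil => simp
    | cons a l =>
      have : a = i := by simpa using hl a (by simp)
      simp [Mon.tip, this] at hn
  | @br₁ A m i b' hm hi him hb' ih =>
    simp only [Mon.tip, Mon.ones, Mon.first] at *
    by_cases hil : i ∈ l
    · obtain ⟨s, t, rfl⟩ := List.append_of_mem hil
      rcases List.eq_nil_or_concat s with rfl | ⟨s, z, rfl⟩
      · refine List.Sublist.cons_cons _ (ih hb.2.2 t (fun a ha => ?_) ?_ ?_)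
        · simp only [List.nil_append, List.cons_append, List.nodup_cons] at hn
          refine Finset.mem_erase.2 ⟨?_, hl a (by simp [ha])⟩
          rintro rfl
          exact hn.1 (by simp [ha])
        · exact hn.of_cons
        · exact hp.tail
      · -- An interior vertex of the path cannot be cut off by a single edge.
        exfalso
        obtain ⟨c, t', hct⟩ : ∃ c t', t ++ [b'.tip] = c :: t' := by
          cases t with
          | nil => exact ⟨_, [], rfl⟩
          | cons c l => exact ⟨c, _, rfl⟩
        have e1 : s ++ [z] ++ i :: t ++ [b'.tip] = s ++ z :: i :: c :: t' := by
          simp [hct]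
        simp only [List.concat_eq_append] at *
        rw [e1] at hn hp
        have hmem : ∀ a ∈ s ++ z :: i :: c :: t', a ∈ A := by
          rw [← e1]
          intro a ha
          rcases List.mem_append.1 ha with h | h
          · exact hl a h
          · rw [List.mem_singleton.1 h]
            exact Finset.erase_subset _ _ (hb'.supp_eq ▸ b'.tip_mem)
        have hp' := (List.isChain_append.1 hp).2.1
        obtain ⟨p1, hp'⟩ := List.isChain_cons_cons.1 hp'
        obtain ⟨p2, -⟩ := List.isChain_cons_cons.1 hp'
        have hn' := (List.nodup_append.1 hn).2.1
        simp only [List.nodup_cons, List.mem_cons, not_or] at hn'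
        obtain ⟨e, he, hec, hx, hu⟩ := hb.1
        rw [hb'.supp_eq] at hu
        have q1 := hu _ p1 (.inr ⟨by simp [hmem z, hn'.1.1], by simp [Mon.supp]⟩)
        have q2 := hu _ p2 (.inl ⟨by simp [Mon.supp],
          by simp [hmem c, Ne.symm hn'.2.1.1]⟩)
        have := q1.trans q2.symm
        simp only [Prod.mk.injEq] at this
        exact hn'.1.1 this.2.1
    · refine List.Sublist.cons _ (ih hb.2.2 l (fun a ha => ?_) hn hp)
      refine Finset.mem_erase.2 ⟨?_, hl a ha⟩
      rintro rfl
      exact hil ha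
  | @br₂ A A₁ A₂ m b₁ b₂ hd hu hm hm2 h1 h2 hf ih1 ih2 =>
    have hc := hb.1
    rw [h1.supp_eq, h2.supp_eq] at hc
    exact ih2 hb.2.2 l (forall_mem_of_isChain hc (h2.supp_eq ▸ b₂.tip_mem) l
      (by rw [hu]; exact hl) hp) hn hp

/-! ### Chains of second brackets -/

/-- The first generator of the list of monomials, or `t` if the list is empty. -/
def headOr : List (Mon I) → I → I
  | [], t => t
  | u :: _, _ => u.first

/-- The graph `E` is, between the monomials of the list `W` and a set `X` of further vertices, a
chain: its only edges lead from the leftmost generator of each monomial to the one of the next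
monomial, and from the last monomial to `t`. On the generators of each monomial it is the graph of
that monomial. -/
def IsGraphChain (E : Finset (Bool × I × I)) : List (Mon I) → Finset I → I → Prop
  | [], _, _ => True
  | u :: W, X, t => (∀ e : Bool × I × I, e.2.1 ∈ u.supp → e.2.2 ∈ u.supp → (e ∈ E ↔ e ∈ u.edges)) ∧
      (∀ e ∈ E, Crosses e u.supp (csupp W ∪ X) → e = (true, u.first, headOr W t)) ∧
      IsGraphChain E W X t

/-- The condition on `E` imposed by the monomials of the list `W` when `E` is taken apart along
`{u₁, {u₂, … {u_r, b}₂ …}₂}₂`, where `W = [u₁, …, u_r]` and `X` is the support of `b`. -/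
def CutChain (E : Finset (Bool × I × I)) : List (Mon I) → Finset I → Prop
  | [], _ => True
  | u :: W, X => CutBy E true u.supp (csupp W ∪ X) ∧ u.Cut E ∧ CutChain E W X

/-- The monomials of the list are single generators or first brackets, belong to the families of
their supports, and have disjoint supports. -/
def IsBlockList : List (Mon I) → Prop
  | [] => True
  | u :: W => LieBasis u.supp u ∧ u.IsBlock ∧ Disjoint u.supp (csupp W) ∧ IsBlockList W

theorem csupp_append (W W' : List (Mon I)) : csupp (W ++ W') = csupp W ∪ csupp W' := by
  induction W with
  | nil => simp [csupp]
  | cons u W ih => simp [csupp, ih, Finset.union_assoc]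

theorem headOr_append (W : List (Mon I)) (u : Mon I) (t : I) :
    headOr (W ++ [u]) t = headOr W u.first := by
  cases W <;> rfl

theorem headOr_mem_of_ne_nil {W : List (Mon I)} (h : W ≠ []) (t : I) : headOr W t ∈ csupp W := by
  cases W with
  | nil => simp at h
  | cons u W => simp [headOr, csupp, Mon.first_mem]

theorem IsBlockList.append {W : List (Mon I)} {u : Mon I} (h : IsBlockList (W ++ [u])) :
    IsBlockList W ∧ LieBasis u.supp u ∧ u.IsBlock ∧ Disjoint (csupp W) u.supp := by
  induction W with
  | nil => exact ⟨trivial, h.1, h.2.1, by simp [csupp]⟩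
  | cons v W ih =>
    obtain ⟨h1, h2, h3, h4⟩ := h
    obtain ⟨i1, i2, i3, i4⟩ := ih h4
    replace h3 : Disjoint v.supp (csupp (W ++ [u])) := h3
    simp only [csupp_append, csupp, Finset.union_empty, Finset.disjoint_union_right] at h3
    refine ⟨⟨h1, h2, h3.1, i1⟩, i2, i3, ?_⟩
    simp only [csupp, Finset.disjoint_union_left]
    exact ⟨h3.2, i4⟩

theorem CutChain.append {E : Finset (Bool × I × I)} {W : List (Mon I)} {u : Mon I} {X : Finset I}
    (h : CutChain E (W ++ [u]) X) :
    CutChain E W (u.supp ∪ X) ∧ CutBy E true u.supp X ∧ u.Cut E := by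
  induction W with
  | nil => exact ⟨trivial, by simpa [csupp] using h.1, h.2.1⟩
  | cons v W ih =>
    obtain ⟨h1, h2, h3⟩ := h
    obtain ⟨i1, i2⟩ := ih h3
    refine ⟨⟨?_, h2, i1⟩, i2⟩
    simpa [csupp_append, csupp, Finset.union_assoc] using h1

theorem IsGraphChain.append {E : Finset (Bool × I × I)} {W : List (Mon I)} {u : Mon I}
    {X : Finset I} {t : I} (h : IsGraphChain E (W ++ [u]) X t) :
    IsGraphChain E W (u.supp ∪ X) u.first ∧ IsGraphChain E [u] X t := by
  induction W with
  | nil => exact ⟨trivial, h⟩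
  | cons v W ih =>
    obtain ⟨h1, h2, h3⟩ := h
    obtain ⟨i1, i2⟩ := ih h3
    refine ⟨⟨h1, ?_, i1⟩, i2⟩
    simpa [csupp_append, csupp, Finset.union_assoc, headOr_append] using h2

/-- A graph chain is linked to the further vertices through its last monomial only. -/
theorem IsGraphChain.eq_of_crosses {E : Finset (Bool × I × I)} {W : List (Mon I)} {X : Finset I}
    {t : I} (h : IsGraphChain E W X t) (hd : Disjoint (csupp W) X) {e : Bool × I × I} (he : e ∈ E)
    (hx : Crosses e (csupp W) X) : ∃ z ∈ csupp W, e = (true, z, t) := by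
  induction W with
  | nil => simp [csupp, Crosses] at hx
  | cons u W ih =>
    obtain ⟨h1, h2, h3⟩ := h
    simp only [csupp, Finset.disjoint_union_left] at hd
    by_cases hxW : Crosses e (csupp W) X
    · obtain ⟨z, hz, rfl⟩ := ih h3 hd.2 hxW
      exact ⟨z, by simp [csupp, hz], rfl⟩
    · have hxu : Crosses e u.supp X := by
        simp only [Crosses, csupp, Finset.mem_union] at *
        tauto
      have := h2 e he (hxu.mono subset_rfl Finset.subset_union_right)
      rcases eq_or_ne W [] with rfl | hW
      · exact ⟨u.first, by simp [csupp, Mon.first_mem], this⟩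
      · exfalso
        have h5 := headOr_mem_of_ne_nil hW t
        have h6 := Finset.disjoint_left.1 hd.2 h5
        have h7 := Finset.disjoint_left.1 hd.1 u.first_mem
        rw [this] at hxu
        simp only [Crosses] at hxu
        tauto

/-- Edges of the first colour do not lead out of the chain that is cut. -/
theorem CutChain.not_crosses {E : Finset (Bool × I × I)} {W : List (Mon I)} {X : Finset I}
    (h : CutChain E W X) {e : Bool × I × I} (he : e ∈ E) (hec : e.1 = false) :
    ¬ Crosses e (csupp W) X := by
  induction W with
  | nil => simp [csupp, Crosses]
  | cons u W ih =>
    intro hx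
    obtain ⟨⟨x, hxE, hxc, hxx, hu⟩, h2, h3⟩ := h
    have hxW := ih h3
    have hxu : Crosses e u.supp X := by
      simp only [Crosses, csupp, Finset.mem_union] at *
      tauto
    rw [hu e he (hxu.mono subset_rfl Finset.subset_union_right), hxc] at hec
    simp at hec

theorem LieBasis.isBlockList_chain {A : Finset I} {b : Mon I} (h : LieBasis A b) :
    IsBlockList b.chain := by
  induction h with
  | gen i => trivial
  | br₁ => trivial
  | @br₂ A A₁ A₂ m b₁ b₂ hd hu hm hm2 h1 h2 hf ih1 ih2 =>
    refine ⟨h1.self, hf, ?_, ih2⟩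
    rw [h1.supp_eq]
    refine hd.mono_right ?_
    rw [← h2.supp_eq, b₂.supp_eq_csupp_union]
    exact Finset.subset_union_left

theorem Mon.Cut.cutChain {E : Finset (Bool × I × I)} {b : Mon I} (h : b.Cut E) :
    CutChain E b.chain b.body.supp := by
  induction b with
  | br₂ s t ihs iht =>
    refine ⟨?_, h.2.1, iht h.2.2⟩
    rw [Mon.body, ← t.supp_eq_csupp_union]
    exact h.1
  | _ => trivial

theorem Mon.headOr_chain (b : Mon I) : headOr b.chain b.body.first = b.first := by
  cases b <;> rfl

/-- The graph of a member of `𝔅(A)` is a chain along the second brackets at its root. -/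
theorem LieBasis.isGraphChain {A : Finset I} {b : Mon I} (h : LieBasis A b)
    {E : Finset (Bool × I × I)}
    (hE : ∀ e : Bool × I × I, e.2.1 ∈ b.supp → e.2.2 ∈ b.supp → (e ∈ E ↔ e ∈ b.edges)) :
    IsGraphChain E b.chain b.body.supp b.body.first := by
  induction h with
  | gen i => trivial
  | br₁ => trivial
  | @br₂ A A₁ A₂ m b₁ b₂ hd hu hm hm2 h1 h2 hf ih1 ih2 =>
    rw [← h1.supp_eq, ← h2.supp_eq] at hd
    have hx : Crosses (true, b₁.first, b₂.first) b₁.supp b₂.supp :=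
      .inl ⟨b₁.first_mem, b₂.first_mem⟩
    simp only [Mon.supp] at hE
    refine ⟨fun e a1 a2 => ?_, fun e he hxe => ?_, ih2 fun e a1 a2 => ?_⟩
    · rw [Mon.edges_congr_left hd hx a1 a2]
      exact hE e (Finset.mem_union_left _ a1) (Finset.mem_union_left _ a2)
    · rw [Mon.body, b₂.headOr_chain]
      rw [Mon.body, ← b₂.supp_eq_csupp_union] at hxe
      have h1 : e.2.1 ∈ b₁.supp ∪ b₂.supp ∧ e.2.2 ∈ b₁.supp ∪ b₂.supp := by
        unfold Crosses at hxe
        grind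
      have := (hE e h1.1 h1.2).1 he
      rcases Finset.mem_insert.1 this with h | h
      · exact h
      · exact absurd hxe (Mon.not_crosses_of_mem_edges hd h)
    · rw [Mon.edges_congr_right hd hx a1 a2]
      exact hE e (Finset.mem_union_right _ a1) (Finset.mem_union_right _ a2)

end Order

/-! ### Triangularity on the Lie families -/

section Key

variable {n : ℕ}

/-- The two parts of the key of a monomial that come from `b.chain` and from `b.body`. -/
def Mon.keys : Mon (Fin n) → List ℕ × List ℕ
  | .gen _ => ([], [])
  | .br₁ _ t => ([], t.ones.length :: (csupp t.chain).card :: (t.keys.1 ++ t.keys.2))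
  | .br₂ u t => (t.keys.1 ++ ((u.tip : ℕ) :: u.ones.length :: (n - u.supp.card) ::
      u.ones.length :: (csupp u.chain).card :: (u.keys.1 ++ u.keys.2)), t.keys.2)
  | .star _ _ => ([], [])

/-- The key by which the members of `𝔅(A)` are ordered: the length of the path of the first
colour to the maximum, the number of generators that the second brackets at the root split off,
the keys of the blocks that contain these generators, the last block first, and the key of what
remains. -/
def Mon.key (b : Mon (Fin n)) : List ℕ :=
  b.ones.length :: (csupp b.chain).card :: (b.keys.1 ++ b.keys.2)

/-- The key of a block in a chain of second brackets; smaller blocks have larger keys, hence the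
difference `n - u.supp.card`. -/
def Mon.blockKey (u : Mon (Fin n)) : List ℕ :=
  (u.tip : ℕ) :: u.ones.length :: (n - u.supp.card) :: u.key

/-- The key of a chain of second brackets: the keys of the blocks, the last one first. -/
def chainKey : List (Mon (Fin n)) → List ℕ
  | [] => []
  | u :: W => chainKey W ++ u.blockKey

/-- The key of the part of a monomial after its first bracket at the root. -/
def Mon.bodyKey : Mon (Fin n) → List ℕ
  | .br₁ _ t => t.key
  | _ => []

theorem Mon.keys_eq (b : Mon (Fin n)) : b.keys = (chainKey b.chain, b.body.bodyKey) := by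
  induction b with
  | gen i => rfl
  | br₁ s t ihs iht => rfl
  | br₂ s t ihs iht =>
    simp only [Mon.keys, Mon.chain, chainKey, Mon.blockKey, Mon.key, Mon.body, iht]
  | star s t ihs iht => rfl

theorem Mon.key_eq (b : Mon (Fin n)) : b.key =
    b.ones.length :: (csupp b.chain).card :: (chainKey b.chain ++ b.body.bodyKey) := by
  rw [Mon.key, Mon.keys_eq]

theorem chainKey_append (W : List (Mon (Fin n))) (u : Mon (Fin n)) :
    chainKey (W ++ [u]) = u.blockKey ++ chainKey W := by
  induction W with
  | nil => simp [chainKey]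
  | cons v W ih => simp [chainKey, ih]

theorem Mon.eq_of_chain_eq {I : Type*} {b b' : Mon I} (hc : b.chain = b'.chain)
    (hb : b.body = b'.body) : b = b' := by
  induction b generalizing b' with
  | br₂ s t ihs iht =>
    cases b' with
    | br₂ s' t' =>
      simp only [Mon.chain, List.cons.injEq] at hc
      rw [hc.1, iht hc.2 hb]
    | _ => simp [Mon.chain] at hc
  | _ =>
    cases b' with
    | br₂ s' t' => simp [Mon.chain] at hc
    | _ => exact hb

theorem Mon.ones_body {I : Type*} (b : Mon I) : b.body.ones = b.ones := by
  induction b with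
  | br₂ s t ihs iht => exact iht
  | _ => rfl

theorem Mon.tip_body {I : Type*} (b : Mon I) : b.body.tip = b.tip := by
  induction b with
  | br₂ s t ihs iht => exact iht
  | _ => rfl

theorem Mon.IsBlock.ones_append_tip {I : Type*} [LinearOrder I] {b : Mon I}
    (h : b.IsBlock) : ∃ l, b.ones ++ [b.tip] = b.first :: l := by
  rcases h with ⟨i, rfl⟩ | ⟨s, t, rfl⟩
  · exact ⟨[], rfl⟩
  · exact ⟨_, rfl⟩

/-- The graph of the body of a monomial is the restriction of the graph of the monomial. -/
theorem LieBasis.mem_edges_body {I : Type*} [LinearOrder I] {A : Finset I} {b : Mon I}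
    (h : LieBasis A b) {e : Bool × I × I} (h1 : e.2.1 ∈ b.body.supp) (h2 : e.2.2 ∈ b.body.supp) :
    e ∈ b.body.edges ↔ e ∈ b.edges := by
  induction h with
  | gen i => rfl
  | br₁ => rfl
  | @br₂ A A₁ A₂ m b₁ b₂ hd hu hm hm2 l1 l2 hf ih1 ih2 =>
    rw [← l1.supp_eq, ← l2.supp_eq] at hd
    have hx : Crosses (true, b₁.first, b₂.first) b₁.supp b₂.supp :=
      .inl ⟨b₁.first_mem, b₂.first_mem⟩
    have hs : b₂.body.supp ⊆ b₂.supp := by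
      rw [b₂.supp_eq_csupp_union]; exact Finset.subset_union_right
    exact (ih2 h1 h2).trans (Mon.edges_congr_right hd hx (hs h1) (hs h2))

/-- The statement that the members of `𝔅(A)` are triangular with respect to their graphs and their
keys, for all sets `A` with fewer than `N` elements. -/
def TriangularBelow (n N : ℕ) : Prop :=
  ∀ (A : Finset (Fin n)) (b b' : Mon (Fin n)) (E : Finset (Bool × Fin n × Fin n)), A.card < N →
    LieBasis A b → LieBasis A b' →
    (∀ e : Bool × Fin n × Fin n, e.2.1 ∈ A → e.2.2 ∈ A → (e ∈ E ↔ e ∈ b.edges)) →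
    b'.Cut E → b' = b ∨ LexLT b.key b'.key

/-- A path of edges of the first colour that starts in the last block of a chain that is cut, stays
inside this block. -/
theorem forall_mem_of_isChain_cons {I : Type*} [LinearOrder I] {E : Finset (Bool × I × I)}
    {W : List (Mon I)} {X B : Finset I} (hc : CutChain E W (B ∪ X)) (l : List I) {a : I}
    (ha : a ∈ B) (hl : ∀ c ∈ l, c ∈ csupp W ∪ B)
    (hp : (a :: l).IsChain fun a a' => (false, a, a') ∈ E) : ∀ c ∈ l, c ∈ B := by
  induction l generalizing a with
  | nil => simp
  | cons d l ih =>
    obtain ⟨h1, h2⟩ := List.isChain_cons_cons.1 hp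
    have hd : d ∈ B := by
      by_contra hd
      have : d ∈ csupp W := by have := hl d (by simp); grind
      exact hc.not_crosses h1 rfl (.inr ⟨Finset.mem_union_left _ ha, this⟩)
    intro c hc
    rcases List.mem_cons.1 hc with rfl | hc
    · exact hd
    · exact ih hd (fun c hc => hl c (List.mem_cons_of_mem _ hc)) h2 c hc

/-- Comparison of two chains of second brackets on the same support, the graph being the one of the
first chain. The last blocks are compared first: the last block of the second chain has to contain
the whole path of the first colour of the last block of the first chain. -/
theorem chain_eq_or_lexLT {N : ℕ} (ih : TriangularBelow n N) {E : Finset (Bool × Fin n × Fin n)}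
    (W : List (Mon (Fin n))) : ∀ (W' : List (Mon (Fin n))) (X : Finset (Fin n)) (t : Fin n),
    (csupp W).card < N → IsBlockList W → IsBlockList W' → csupp W' = csupp W →
    Disjoint (csupp W) X → t ∈ X → IsGraphChain E W X t → CutChain E W' X →
    W' = W ∨ LexLT (chainKey W) (chainKey W') := by
  induction W using List.reverseRecOn with
  | nil =>
    intro W' X t _ _ _ hs _ _ _ _
    left
    cases W' with
    | nil => rfl
    | cons u W' =>
      have := u.first_mem
      simp only [csupp, Finset.union_eq_empty] at hs
      rw [hs.1] at this
      simp at this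
  | append_singleton W u ihW =>
    intro W' X t hN hW hW' hs hd ht hG hC
    rcases List.eq_nil_or_concat W' with rfl | ⟨W', u', rfl⟩
    · have := u.first_mem
      simp only [csupp_append, csupp, Finset.union_empty] at hs
      have h2 : u.supp = ∅ := (Finset.union_eq_empty.1 hs.symm).2
      rw [h2] at this
      simp at this
    simp only [List.concat_eq_append] at *
    obtain ⟨hW1, hW2, hW3, hW4⟩ := hW.append
    obtain ⟨hW1', hW2', hW3', hW4'⟩ := hW'.append
    obtain ⟨hG1, hG2⟩ := hG.append
    obtain ⟨hC1, hC2, hC3⟩ := hC.append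
    have eW : csupp (W ++ [u]) = csupp W ∪ u.supp := by simp [csupp_append, csupp]
    have eW' : csupp (W' ++ [u']) = csupp W' ∪ u'.supp := by simp [csupp_append, csupp]
    have hd1 : Disjoint (csupp W) (u.supp ∪ X) := by
      rw [eW, Finset.disjoint_union_left] at hd
      exact Finset.disjoint_union_right.2 ⟨hW4, hd.1⟩
    have huX : Disjoint u.supp X := by
      rw [eW, Finset.disjoint_union_left] at hd
      exact hd.2
    have hcard : u.supp.card < N := lt_of_le_of_lt (Finset.card_le_card (by grind)) hN
    -- The link to `t` shows that the leftmost generator of `u` belongs to `u'`.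
    have hfirst : u.first ∈ u'.supp := by
      obtain ⟨e, he, -, hx, -⟩ := hC2
      have hx' : Crosses e (csupp (W ++ [u])) X := hx.mono (by grind) subset_rfl
      have hd' := Finset.disjoint_left.1 hd
      have h1 : e = (true, u.first, t) := by
        obtain ⟨z, hz, rfl⟩ := hG.eq_of_crosses hd he hx'
        by_cases hzu : z ∈ u.supp
        · exact hG2.2.1 _ he (.inl ⟨hzu, by simp [csupp, ht]⟩)
        · exfalso
          have hzW : z ∈ csupp W := by grind
          obtain ⟨z', -, h⟩ := hG1.eq_of_crosses hd1 he
            (.inl ⟨hzW, Finset.mem_union_right _ ht⟩)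
          simp only [Prod.mk.injEq, true_and] at h
          exact Finset.disjoint_left.1 huX u.first_mem (h.2 ▸ ht)
      rw [h1] at hx
      have h2 : u.first ∈ csupp (W ++ [u]) := by
        rw [eW]; exact Finset.mem_union_right _ u.first_mem
      rcases hx with hx | hx
      · exact hx.1
      · exact absurd hx.1 (hd' h2)
    obtain ⟨l, hl⟩ := hW3.ones_append_tip
    have hpath : (u.ones ++ [u.tip]).IsChain fun a a' => (false, a, a') ∈ E := by
      refine u.isChain_edges.imp fun a a' h => ?_
      have := Mon.mem_supp_of_mem_edges h
      exact (hG2.1 _ this.1 this.2).2 h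
    have hsub : ∀ c ∈ u.ones ++ [u.tip], c ∈ u.supp := by
      intro c hc
      rcases List.mem_append.1 hc with h | h
      · exact Mon.mem_supp_of_mem_ones h
      · rw [List.mem_singleton.1 h]; exact u.tip_mem
    have hin : ∀ c ∈ u.ones ++ [u.tip], c ∈ u'.supp := by
      rw [hl] at hpath hsub ⊢
      have := forall_mem_of_isChain_cons hC1 l hfirst (fun c hc => ?_) hpath
      · intro c hc
        rcases List.mem_cons.1 hc with rfl | hc
        · exact hfirst
        · exact this c hc
      · rw [← eW', hs, eW]
        exact Finset.mem_union_right _ (hsub c (List.mem_cons_of_mem _ hc))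
    have htip : u.tip ≤ u'.tip := hW2'.isGreatest_tip.2 (hin _ (by simp))
    rw [chainKey_append, chainKey_append]
    rcases htip.lt_or_eq with htip | htip
    · exact .inr ((LexLT.head htip _ _).append_right _ _)
    have hones : u.ones.Sublist u'.ones := by
      refine hW2'.sublist_ones hC3 _ (fun a ha => hin a (by simp [ha])) ?_ ?_
      · rw [← htip]; exact hW2.nodup
      · rw [← htip]; exact hpath
    rcases hones.length_le.lt_or_eq with hlen | hlen
    · right
      simp only [Mon.blockKey, htip]
      exact ((LexLT.head hlen _ _).cons _).append_right _ _
    have hones' := hones.eq_of_length hlen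
    -- The only link of `u` to the preceding blocks starts in its leftmost generator, which is cut
    -- off first in `u'`.
    have hsupp : u'.supp ⊆ u.supp := by
      intro z hz
      by_contra hzu
      obtain ⟨e, he, hx⟩ := hW2'.connected hC3 u.supp hfirst u.first_mem hz hzu
      have h0 : u'.supp \ u.supp ⊆ csupp W := by
        intro y hy
        have : y ∈ csupp W ∪ u.supp := by
          rw [← eW, ← hs, eW']
          exact Finset.mem_union_right _ (Finset.mem_sdiff.1 hy).1
        grind
      obtain ⟨y, hy, rfl⟩ := hG1.eq_of_crosses hd1 he (hx.symm.mono h0 (by grind))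
      have hyu : y ∉ u.supp := fun h => Finset.disjoint_left.1 hW4 hy h
      have hyu' : y ∈ u'.supp := by
        rcases hx with hx | hx
        · exact absurd (Finset.mem_inter.1 hx.1).2 hyu
        · exact (Finset.mem_sdiff.1 hx.1).1
      have hne : y ≠ u.first := fun h => hyu (h ▸ u.first_mem)
      rcases hW3' with ⟨i, rfl⟩ | ⟨s, r, rfl⟩
      · simp only [Mon.supp, Finset.mem_singleton] at hfirst hyu'
        exact hne (hyu'.trans hfirst.symm)
      · obtain ⟨i, rfl, -, -, hr⟩ := hW2'.inv_br₁
        have hi : u.first = i := by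
          rw [hones'] at hl
          simp only [Mon.ones, Mon.first, List.cons_append, List.cons.injEq] at hl
          exact hl.1.symm
        obtain ⟨x, hxE, hxc, hxx, hu⟩ := hC3.1
        have hyr : y ∈ r.supp := by
          simp only [Mon.supp, Finset.mem_union, Finset.mem_singleton] at hyu'
          rcases hyu' with h | h
          · exact absurd (h.trans hi.symm) hne
          · exact h
        have := hu _ he (.inr ⟨hyr, by simp [Mon.supp, hi]⟩)
        rw [← this] at hxc
        simp at hxc
    by_cases heq : u'.supp = u.supp
    · rcases ih u.supp u u' E hcard hW2 (heq ▸ hW2') hG2.1 hC3 with rfl | hlt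
      · have hs' : csupp W' = csupp W := by
          have h3 := Finset.disjoint_left.1 hW4
          have h3' := Finset.disjoint_left.1 hW4'
          rw [eW, eW'] at hs
          ext x
          have := Finset.ext_iff.1 hs x
          simp only [Finset.mem_union] at this
          have := @h3 x
          have := @h3' x
          tauto
        rcases ihW W' (u'.supp ∪ X) u'.first (lt_of_le_of_lt (Finset.card_le_card (by grind)) hN)
          hW1 hW1' hs' hd1 (Finset.mem_union_left _ u'.first_mem) hG1 hC1 with rfl | hlt
        · exact .inl rfl
        · exact .inr (hlt.append_left _)
      · right
        simp only [Mon.blockKey, htip, hlen, heq]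
        exact (((hlt.cons _).cons _).cons _).append_right _ _
    · right
      have hc1 : u'.supp.card < u.supp.card :=
        Finset.card_lt_card (lt_of_le_of_ne hsupp heq)
      have hc2 : u.supp.card ≤ n := by simpa using Finset.card_le_univ u.supp
      simp only [Mon.blockKey, htip, hlen]
      exact (((LexLT.head (by omega) _ _).cons _).cons _).append_right _ _

/-- If the graph of `b` can be taken apart along `b'`, then `b' = b` or the key of `b'` is larger
than the one of `b`. -/
theorem triangularBelow (n N : ℕ) : TriangularBelow n N := by
  induction N with
  | zero => intro A b b' E hA; simp at hA
  | succ N ih =>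
    intro A b b' E hA hb hb' hE hcut
    have hs := hb.supp_eq
    have hs' := hb'.supp_eq
    have htip : b.tip = b'.tip := hb.isGreatest_tip.unique hb'.isGreatest_tip
    have hones : b.ones.Sublist b'.ones := by
      refine hb'.sublist_ones hcut _ (fun a ha => hs ▸ Mon.mem_supp_of_mem_ones ha) ?_ ?_
      · rw [← htip]; exact hb.nodup
      · rw [← htip]
        refine b.isChain_edges.imp fun a a' h => ?_
        have := Mon.mem_supp_of_mem_edges h
        rw [hs] at this
        exact (hE _ this.1 this.2).2 h
    rw [Mon.key_eq, Mon.key_eq]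
    rcases hones.length_le.lt_or_eq with hlen | hlen
    · exact .inr (LexLT.head hlen _ _)
    have hones' := hones.eq_of_length hlen
    obtain ⟨hB1, hB2, hB3⟩ := hb.body
    obtain ⟨hB1', hB2', hB3'⟩ := hb'.body
    have hu := b.supp_eq_csupp_union
    have hu' := b'.supp_eq_csupp_union
    rw [hs] at hu
    rw [hs'] at hu'
    have hG := hb.isGraphChain (E := E) (by rw [hs]; exact hE)
    have hC := hcut.cutChain
    have hcutB := hcut.body
    -- The vertex to which the chain of `b` is linked.
    have hfirst : b.body.first = b'.body.first := by
      obtain ⟨l, hl⟩ := hB2.ones_append_tip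
      obtain ⟨l', hl'⟩ := hB2'.ones_append_tip
      rw [Mon.ones_body, Mon.tip_body, hones', htip] at hl
      rw [Mon.ones_body, Mon.tip_body, hl] at hl'
      exact (List.cons.inj hl').1
    have hsub : csupp b.chain ⊆ csupp b'.chain := by
      intro z hz
      by_contra hz'
      have hzb : z ∈ b'.body.supp := by
        have : z ∈ A := by rw [hu]; exact Finset.mem_union_left _ hz
        rw [hu'] at this
        grind
      have hf : b'.body.first ∉ csupp b.chain := fun h =>
        Finset.disjoint_left.1 hB3 h (hfirst ▸ b.body.first_mem)
      obtain ⟨e, he, hx⟩ := hB1'.connected hcutB (csupp b.chain) hzb hz b'.body.first_mem hf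
      have h0 : b'.body.supp \ csupp b.chain ⊆ b.body.supp := by
        intro y hy
        have : y ∈ A := by rw [hu']; exact Finset.mem_union_right _ (Finset.mem_sdiff.1 hy).1
        rw [hu] at this
        grind
      obtain ⟨y, hy, rfl⟩ := hG.eq_of_crosses hB3 he (hx.mono Finset.inter_subset_right h0)
      have hyu' : y ∈ b'.body.supp := by
        rcases hx with hx | hx
        · exact (Finset.mem_inter.1 hx.1).1
        · exact absurd hy (Finset.mem_sdiff.1 hx.1).2
      have hne : y ≠ b'.body.first := fun h => hf (h ▸ hy)
      rcases hB2' with ⟨i, hi⟩ | ⟨s, r, hsr⟩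
      · rw [hi] at hyu' hne
        simp only [Mon.supp, Finset.mem_singleton, Mon.first] at hyu' hne
        exact hne hyu'
      · rw [hsr] at hB1' hcutB hfirst hne hyu'
        obtain ⟨i, rfl, -, -, hr⟩ := hB1'.inv_br₁
        obtain ⟨x, hxE, hxc, hxx, hun⟩ := hcutB.1
        simp only [Mon.supp, Finset.mem_union, Finset.mem_singleton, Mon.first] at hyu' hne hfirst
        have hyr : y ∈ r.supp := hyu'.resolve_left hne
        have := hun _ he (.inr ⟨hyr, by simp [Mon.supp, hfirst]⟩)
        rw [← this] at hxc
        simp at hxc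
    rcases (Finset.card_le_card hsub).lt_or_eq with hcard | hcard
    · rw [hlen]
      exact .inr ((LexLT.head hcard _ _).cons _)
    have hcs : csupp b'.chain = csupp b.chain :=
      (Finset.eq_of_subset_of_card_le hsub hcard.ge).symm
    have hbs : b'.body.supp = b.body.supp := by
      have h3 := Finset.disjoint_left.1 hB3
      have h3' := Finset.disjoint_left.1 hB3'
      rw [hu, hcs] at hu'
      ext x
      have := Finset.ext_iff.1 hu' x
      simp only [Finset.mem_union] at this
      have := @h3 x
      have := @h3' x
      rw [hcs] at this
      tauto
    have hltN : (csupp b.chain).card < N := by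
      have h1 : (csupp b.chain).card < A.card := by
        refine Finset.card_lt_card ⟨by grind, fun h => ?_⟩
        have h1 : b.body.first ∈ A := by
          rw [hu]; exact Finset.mem_union_right _ b.body.first_mem
        exact Finset.disjoint_left.1 hB3 (h h1) b.body.first_mem
      omega
    rw [hlen, hcard]
    rcases chain_eq_or_lexLT ih b.chain b'.chain b.body.supp b.body.first hltN
      hb.isBlockList_chain hb'.isBlockList_chain hcs hB3 b.body.first_mem hG (hbs ▸ hC)
      with hch | hlt
    swap
    · exact .inr (((hlt.append_right _ _).cons _).cons _)
    rw [hch]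
    have hbody : b'.body = b.body ∨ LexLT b.body.bodyKey b'.body.bodyKey := by
      rcases hB2 with ⟨i, hi⟩ | ⟨s, r, hsr⟩
      · rcases hB2' with ⟨j, hj⟩ | ⟨s', r', hsr'⟩
        · rw [hi, hj] at hfirst ⊢
          exact .inl (by rw [show i = j from hfirst])
        · rw [← Mon.ones_body, hi, ← b'.ones_body, hsr'] at hones'
          simp [Mon.ones] at hones'
      · rcases hB2' with ⟨j, hj⟩ | ⟨s', r', hsr'⟩
        · rw [← Mon.ones_body, hsr, ← b'.ones_body, hj] at hones'
          simp [Mon.ones] at hones'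
        · have hEr : ∀ e : Bool × Fin n × Fin n, e.2.1 ∈ b.body.supp → e.2.2 ∈ b.body.supp →
              (e ∈ E ↔ e ∈ b.body.edges) := by
            intro e h1 h2
            rw [hE e (hu ▸ Finset.mem_union_right _ h1) (hu ▸ Finset.mem_union_right _ h2)]
            exact (hb.mem_edges_body h1 h2).symm
          rw [hsr] at hB1 hfirst hbs hEr ⊢
          rw [hsr'] at hB1' hfirst hcutB hbs ⊢
          have hdr := hB1.disjoint_br₁
          obtain ⟨i, rfl, hi1, hi2, hr⟩ := hB1.inv_br₁
          obtain ⟨i', rfl, hi1', hi2', hr'⟩ := hB1'.inv_br₁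
          obtain rfl : i = i' := hfirst
          rw [hbs] at hr'
          have hx : Crosses (false, (Mon.gen i).first, r.next) (Mon.gen i).supp r.supp :=
            .inl ⟨Mon.first_mem _, r.next_mem⟩
          have hrs := hr.supp_eq
          have hrN : ((Mon.br₁ (Mon.gen i) r).supp.erase i).card < N := by
            have h1 : (Mon.br₁ (Mon.gen i) r).supp.card ≤ A.card := by
              rw [← hsr]
              exact Finset.card_le_card (by grind)
            have h2 := Finset.card_erase_lt_of_mem hi1
            omega
          have hrE : ∀ e : Bool × Fin n × Fin n, e.2.1 ∈ (Mon.br₁ (Mon.gen i) r).supp.erase i →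
              e.2.2 ∈ (Mon.br₁ (Mon.gen i) r).supp.erase i → (e ∈ E ↔ e ∈ r.edges) := by
            intro e h1 h2
            rw [← hrs] at h1 h2
            rw [Mon.edges_congr_right hdr hx h1 h2]
            exact hEr e (Finset.mem_union_right _ h1) (Finset.mem_union_right _ h2)
          rcases ih _ r r' E hrN hr hr' hrE hcutB.2.2 with rfl | hlt
          · exact .inl rfl
          · exact .inr hlt
    rcases hbody with hbody | hlt
    · exact .inl (Mon.eq_of_chain_eq hch hbody)
    · exact .inr (((hlt.append_left _).cons _).cons _)

end Key

/-! ### The algebra attached to a two-coloured graph -/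

section Pairing

variable {I : Type*} [DecidableEq I]

/-- The number of edges of `E` between two multisets of vertices. -/
def crossings (E : Finset (Bool × I × I)) (A B : Multiset I) : ℕ :=
  ∑ e ∈ E, (A.count e.2.1 * B.count e.2.2 + A.count e.2.2 * B.count e.2.1)

/-- The number of edges of colour `c` from `A` to `B`, minus the number of those from `B`
to `A`. -/
def flow (E : Finset (Bool × I × I)) (c : Bool) (A B : Multiset I) : ℚ :=
  ∑ e ∈ E with e.1 = c,
    ((A.count e.2.1 : ℚ) * B.count e.2.2 - A.count e.2.2 * B.count e.2.1)

/-- The structure constant of the bracket of colour `c` in the algebra attached to the graph. -/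
def bracketCoeff (E : Finset (Bool × I × I)) (c : Bool) (A B : Multiset I) : ℚ :=
  if crossings E A B = 1 then flow E c A B else 0

/-- The structure constant of the product in the algebra attached to the graph. -/
def mulCoeff (E : Finset (Bool × I × I)) (A B : Multiset I) : ℚ :=
  if crossings E A B = 0 then 1 else 0

/-- The bilinear operation on the space with basis all multisets in `I` that has the structure
constants `κ` and is graded by addition of multisets. -/
noncomputable def gradedOp (κ : Multiset I → Multiset I → ℚ) :
    (Multiset I →₀ ℚ) →ₗ[ℚ] (Multiset I →₀ ℚ) →ₗ[ℚ] (Multiset I →₀ ℚ) :=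
  Finsupp.linearCombination ℚ fun A =>
    Finsupp.linearCombination ℚ fun B => Finsupp.single (A + B) (κ A B)

/-- The pairing of a monomial with a graph: the product of the structure constants of all the
operations that occur in the monomial. -/
def Mon.pairing (E : Finset (Bool × I × I)) : Mon I → ℚ
  | .gen _ => 1
  | .br₁ s t => bracketCoeff E false s.leaves t.leaves * (s.pairing E * t.pairing E)
  | .br₂ s t => bracketCoeff E true s.leaves t.leaves * (s.pairing E * t.pairing E)
  | .star s t => mulCoeff E s.leaves t.leaves * (s.pairing E * t.pairing E)

/-- The homomorphism from the free algebra to the algebra attached to the graph. -/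
noncomputable def toGraded (E : Finset (Bool × I × I)) :
    FreeMagmatic I →ₗ[ℚ] (Multiset I →₀ ℚ) :=
  Finsupp.linearCombination ℚ fun m => Finsupp.single m.leaves (m.pairing E)

theorem crossings_comm (E : Finset (Bool × I × I)) (A B : Multiset I) :
    crossings E A B = crossings E B A :=
  Finset.sum_congr rfl fun e _ => by ring

theorem crossings_add_right (E : Finset (Bool × I × I)) (A B C : Multiset I) :
    crossings E A (B + C) = crossings E A B + crossings E A C := by
  simp only [crossings, Multiset.count_add, ← Finset.sum_add_distrib]
  exact Finset.sum_congr rfl fun e _ => by ring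

theorem crossings_add_left (E : Finset (Bool × I × I)) (A B C : Multiset I) :
    crossings E (A + B) C = crossings E A C + crossings E B C := by
  rw [crossings_comm, crossings_add_right, crossings_comm E C A, crossings_comm E C B]

theorem flow_skew (E : Finset (Bool × I × I)) (c : Bool) (A B : Multiset I) :
    flow E c A B = - flow E c B A := by
  simp only [flow, ← Finset.sum_neg_distrib]
  exact Finset.sum_congr rfl fun e _ => by ring

theorem flow_add_right (E : Finset (Bool × I × I)) (c : Bool) (A B C : Multiset I) :
    flow E c A (B + C) = flow E c A B + flow E c A C := by
  simp only [flow, Multiset.count_add, ← Finset.sum_add_distrib]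
  exact Finset.sum_congr rfl fun e _ => by push_cast; ring

theorem flow_eq_zero {E : Finset (Bool × I × I)} {A B : Multiset I} (h : crossings E A B = 0)
    (c : Bool) : flow E c A B = 0 := by
  refine Finset.sum_eq_zero fun e he => ?_
  have := Finset.sum_eq_zero_iff.1 h e (Finset.mem_filter.1 he).1
  have h1 : A.count e.2.1 * B.count e.2.2 = 0 := by omega
  have h2 : A.count e.2.2 * B.count e.2.1 = 0 := by omega
  rw [← Nat.cast_mul, ← Nat.cast_mul, h1, h2]
  simp

theorem bracketCoeff_skew (E : Finset (Bool × I × I)) (c : Bool) (A B : Multiset I) :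
    bracketCoeff E c A B = - bracketCoeff E c B A := by
  simp only [bracketCoeff, crossings_comm E A B, flow_skew E c A B]
  split_ifs <;> simp

theorem mulCoeff_comm (E : Finset (Bool × I × I)) (A B : Multiset I) :
    mulCoeff E A B = mulCoeff E B A := by
  simp only [mulCoeff, crossings_comm E A B]

theorem mulCoeff_assoc (E : Finset (Bool × I × I)) (A B C : Multiset I) :
    mulCoeff E (A + B) C * mulCoeff E A B = mulCoeff E A (B + C) * mulCoeff E B C := by
  simp only [mulCoeff, crossings_add_left, crossings_add_right]
  split_ifs <;> first | omega | simp

/-- The six-term identity for the structure constants of two colours; for equal colours it is twice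
the Jacobi identity. A term is nonzero only if the three multisets are joined by two edges that form
a path with one of the multisets in the middle; each product of a flow along the one edge and a flow
along the other edge then occurs twice, with opposite signs. -/
theorem bracketCoeff_jacobi (E : Finset (Bool × I × I)) (c d : Bool) (A B C : Multiset I) :
    bracketCoeff E c A (B + C) * bracketCoeff E d B C +
      bracketCoeff E c B (C + A) * bracketCoeff E d C A +
      bracketCoeff E c C (A + B) * bracketCoeff E d A B +
      bracketCoeff E d A (B + C) * bracketCoeff E c B C +
      bracketCoeff E d B (C + A) * bracketCoeff E c C A +
      bracketCoeff E d C (A + B) * bracketCoeff E c A B = 0 := by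
  have z1 := flow_eq_zero (E := E) (A := A) (B := B) (c := c)
  have z1' := flow_eq_zero (E := E) (A := A) (B := B) (c := d)
  have z2 := flow_eq_zero (E := E) (A := B) (B := C) (c := c)
  have z2' := flow_eq_zero (E := E) (A := B) (B := C) (c := d)
  have z3 := flow_eq_zero (E := E) (A := C) (B := A) (c := c)
  have z3' := flow_eq_zero (E := E) (A := C) (B := A) (c := d)
  simp only [bracketCoeff, crossings_add_right, flow_add_right, crossings_comm E B A,
    crossings_comm E C B, crossings_comm E A C, flow_skew E _ B A, flow_skew E _ C B,
    flow_skew E _ A C]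
  generalize crossings E A B = n1 at *
  generalize crossings E B C = n2 at *
  generalize crossings E C A = n3 at *
  have tri : ∀ k : ℕ, k = 0 ∨ k = 1 ∨ ∃ j, k = j + 2 := fun k => by
    rcases k with _ | _ | k
    · exact .inl rfl
    · exact .inr (.inl rfl)
    · exact .inr (.inr ⟨k, rfl⟩)
  have big : ∀ j k : ℕ, j + 2 + (k + 2) ≠ 1 := by omega
  rcases tri n1 with rfl | rfl | ⟨j1, rfl⟩ <;> rcases tri n2 with rfl | rfl | ⟨j2, rfl⟩ <;>
    rcases tri n3 with rfl | rfl | ⟨j3, rfl⟩ <;> simp_all <;> try ring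

theorem bracketCoeff_leibniz (E : Finset (Bool × I × I)) (c : Bool) (A B C : Multiset I) :
    bracketCoeff E c A (B + C) * mulCoeff E B C =
      mulCoeff E (A + B) C * bracketCoeff E c A B +
        mulCoeff E B (A + C) * bracketCoeff E c A C := by
  have z1 := flow_eq_zero (E := E) (A := A) (B := B) (c := c)
  have z2 := flow_eq_zero (E := E) (A := A) (B := C) (c := c)
  simp only [bracketCoeff, mulCoeff, crossings_add_right, crossings_add_left, flow_add_right,
    crossings_comm E B A]
  generalize crossings E A B = n1 at *
  generalize crossings E B C = n2 at *
  generalize crossings E A C = n3 at *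
  have tri : ∀ k : ℕ, k = 0 ∨ k = 1 ∨ ∃ j, k = j + 2 := fun k => by
    rcases k with _ | _ | k
    · exact .inl rfl
    · exact .inr (.inl rfl)
    · exact .inr (.inr ⟨k, rfl⟩)
  have big : ∀ j k : ℕ, j + 2 + (k + 2) ≠ 1 := by omega
  rcases tri n1 with rfl | rfl | ⟨j1, rfl⟩ <;> rcases tri n2 with rfl | rfl | ⟨j2, rfl⟩ <;>
    rcases tri n3 with rfl | rfl | ⟨j3, rfl⟩ <;> simp_all

theorem gradedOp_single (κ : Multiset I → Multiset I → ℚ) (A B : Multiset I) (x y : ℚ) :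
    gradedOp κ (Finsupp.single A x) (Finsupp.single B y) =
      Finsupp.single (A + B) (κ A B * (x * y)) := by
  simp only [gradedOp, Finsupp.linearCombination_single, LinearMap.smul_apply, Finsupp.smul_single,
    smul_eq_mul]
  congr 1
  ring

theorem extendOp_single {I : Type*} (f : Mon I → Mon I → Mon I) (s t : Mon I) (x y : ℚ) :
    extendOp f (Finsupp.single s x) (Finsupp.single t y) = Finsupp.single (f s t) (x * y) := by
  simp [extendOp, Finsupp.linearCombination_single]

theorem toGraded_extendOp (E : Finset (Bool × I × I)) (f : Mon I → Mon I → Mon I)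
    (κ : Multiset I → Multiset I → ℚ) (hl : ∀ s t, (f s t).leaves = s.leaves + t.leaves)
    (hp : ∀ s t, (f s t).pairing E = κ s.leaves t.leaves * (s.pairing E * t.pairing E))
    (x y : FreeMagmatic I) :
    toGraded E (extendOp f x y) = gradedOp κ (toGraded E x) (toGraded E y) := by
  induction x using Finsupp.induction_linear with
  | zero => simp
  | add x x' hx hx' => simp only [map_add, LinearMap.add_apply, hx, hx']
  | single s a =>
    induction y using Finsupp.induction_linear with
    | zero => simp
    | add y y' hy hy' => simp only [map_add, hy, hy']
    | single t b =>
      rw [extendOp_single]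
      simp only [toGraded, Finsupp.linearCombination_single, Finsupp.smul_single, smul_eq_mul,
        gradedOp_single, hl, hp]
      congr 1
      ring

/-- Induction principle for identities that are trilinear. -/
theorem trilinear_induction {P : (Multiset I →₀ ℚ) → (Multiset I →₀ ℚ) → (Multiset I →₀ ℚ) →
      (Multiset I →₀ ℚ)} (h1 : ∀ x x' y z, P (x + x') y z = P x y z + P x' y z)
    (h2 : ∀ x y y' z, P x (y + y') z = P x y z + P x y' z)
    (h3 : ∀ x y z z', P x y (z + z') = P x y z + P x y z')
    (hs : ∀ A B C a b c, P (Finsupp.single A a) (Finsupp.single B b) (Finsupp.single C c) = 0)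
    (x y z : Multiset I →₀ ℚ) : P x y z = 0 := by
  have z1 : ∀ y z, P 0 y z = 0 := fun y z => by simpa using h1 0 0 y z
  have z2 : ∀ x z, P x 0 z = 0 := fun x z => by simpa using h2 x 0 0 z
  have z3 : ∀ x y, P x y 0 = 0 := fun x y => by simpa using h3 x y 0 0
  induction x using Finsupp.induction_linear with
  | zero => exact z1 _ _
  | add x x' hx hx' => rw [h1, hx, hx', add_zero]
  | single A a =>
    induction y using Finsupp.induction_linear with
    | zero => exact z2 _ _
    | add y y' hy hy' => rw [h2, hy, hy', add_zero]
    | single B b =>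
      induction z using Finsupp.induction_linear with
      | zero => exact z3 _ _
      | add z z' hz hz' => rw [h3, hz, hz', add_zero]
      | single C c => exact hs A B C a b c

theorem gradedOp_six (E : Finset (Bool × I × I)) (c d : Bool) (x y z : Multiset I →₀ ℚ) :
    gradedOp (bracketCoeff E c) x (gradedOp (bracketCoeff E d) y z) +
      gradedOp (bracketCoeff E c) y (gradedOp (bracketCoeff E d) z x) +
      gradedOp (bracketCoeff E c) z (gradedOp (bracketCoeff E d) x y) +
      gradedOp (bracketCoeff E d) x (gradedOp (bracketCoeff E c) y z) +
      gradedOp (bracketCoeff E d) y (gradedOp (bracketCoeff E c) z x) +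
      gradedOp (bracketCoeff E d) z (gradedOp (bracketCoeff E c) x y) = 0 := by
  refine trilinear_induction (P := fun x y z => gradedOp (bracketCoeff E c) x
    (gradedOp (bracketCoeff E d) y z) +
      gradedOp (bracketCoeff E c) y (gradedOp (bracketCoeff E d) z x) +
      gradedOp (bracketCoeff E c) z (gradedOp (bracketCoeff E d) x y) +
      gradedOp (bracketCoeff E d) x (gradedOp (bracketCoeff E c) y z) +
      gradedOp (bracketCoeff E d) y (gradedOp (bracketCoeff E c) z x) +
      gradedOp (bracketCoeff E d) z (gradedOp (bracketCoeff E c) x y)) ?_ ?_ ?_ ?_ x y z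
  · intros; simp only [map_add, LinearMap.add_apply]; abel
  · intros; simp only [map_add, LinearMap.add_apply]; abel
  · intros; simp only [map_add, LinearMap.add_apply]; abel
  · intro A B C a b e
    have e1 : B + (C + A) = A + (B + C) := by abel
    have e2 : C + (A + B) = A + (B + C) := by abel
    simp only [gradedOp_single, e1, e2, ← Finsupp.single_add]
    rw [Finsupp.single_eq_zero]
    linear_combination (a * b * e) * bracketCoeff_jacobi E c d A B C

theorem gradedOp_jacobi (E : Finset (Bool × I × I)) (c : Bool) (x y z : Multiset I →₀ ℚ) :
    gradedOp (bracketCoeff E c) x (gradedOp (bracketCoeff E c) y z) +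
      gradedOp (bracketCoeff E c) y (gradedOp (bracketCoeff E c) z x) +
      gradedOp (bracketCoeff E c) z (gradedOp (bracketCoeff E c) x y) = 0 := by
  refine (smul_eq_zero.1 ?_).resolve_left (two_ne_zero (α := ℚ))
  rw [← gradedOp_six E c c x y z, two_smul]
  abel

theorem gradedOp_swap {κ : Multiset I → Multiset I → ℚ} {ε : ℚ} (h : ∀ A B, κ A B = ε * κ B A)
    (x y : Multiset I →₀ ℚ) : gradedOp κ x y = ε • gradedOp κ y x := by
  induction x using Finsupp.induction_linear with
  | zero => simp
  | add x x' hx hx' => simp only [map_add, LinearMap.add_apply, hx, hx', smul_add]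
  | single A a =>
    induction y using Finsupp.induction_linear with
    | zero => simp
    | add y y' hy hy' => simp only [map_add, LinearMap.add_apply, hy, hy', smul_add]
    | single B b =>
      rw [gradedOp_single, gradedOp_single, h, Finsupp.smul_single, add_comm A B, smul_eq_mul]
      congr 1
      ring

theorem gradedOp_assoc (E : Finset (Bool × I × I)) (x y z : Multiset I →₀ ℚ) :
    gradedOp (mulCoeff E) (gradedOp (mulCoeff E) x y) z -
      gradedOp (mulCoeff E) x (gradedOp (mulCoeff E) y z) = 0 := by
  refine trilinear_induction (P := fun x y z =>
    gradedOp (mulCoeff E) (gradedOp (mulCoeff E) x y) z -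
      gradedOp (mulCoeff E) x (gradedOp (mulCoeff E) y z)) ?_ ?_ ?_ ?_ x y z
  · intros; simp only [map_add, LinearMap.add_apply]; abel
  · intros; simp only [map_add, LinearMap.add_apply]; abel
  · intros; simp only [map_add]; abel
  · intro A B C a b c
    simp only [gradedOp_single, add_assoc A B C, ← Finsupp.single_sub]
    rw [Finsupp.single_eq_zero]
    linear_combination (a * b * c) * mulCoeff_assoc E A B C

theorem gradedOp_leibniz (E : Finset (Bool × I × I)) (c : Bool) (x y z : Multiset I →₀ ℚ) :
    gradedOp (bracketCoeff E c) x (gradedOp (mulCoeff E) y z) -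
      (gradedOp (mulCoeff E) (gradedOp (bracketCoeff E c) x y) z +
        gradedOp (mulCoeff E) y (gradedOp (bracketCoeff E c) x z)) = 0 := by
  refine trilinear_induction (P := fun x y z =>
    gradedOp (bracketCoeff E c) x (gradedOp (mulCoeff E) y z) -
      (gradedOp (mulCoeff E) (gradedOp (bracketCoeff E c) x y) z +
        gradedOp (mulCoeff E) y (gradedOp (bracketCoeff E c) x z))) ?_ ?_ ?_ ?_ x y z
  · intros; simp only [map_add, LinearMap.add_apply]; abel
  · intros; simp only [map_add, LinearMap.add_apply]; abel
  · intros; simp only [map_add]; abel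
  · intro A B C a b e
    have e1 : A + B + C = A + (B + C) := by abel
    have e2 : B + (A + C) = A + (B + C) := by abel
    simp only [gradedOp_single, e1, e2, ← Finsupp.single_add, ← Finsupp.single_sub]
    rw [Finsupp.single_eq_zero]
    linear_combination (a * b * e) * bracketCoeff_leibniz E c A B C

theorem toGraded_bracket₁ (E : Finset (Bool × I × I)) (x y : FreeMagmatic I) :
    toGraded E (bracket₁ x y) = gradedOp (bracketCoeff E false) (toGraded E x) (toGraded E y) :=
  toGraded_extendOp E _ _ (fun _ _ => rfl) (fun _ _ => rfl) x y

theorem toGraded_bracket₂ (E : Finset (Bool × I × I)) (x y : FreeMagmatic I) :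
    toGraded E (bracket₂ x y) = gradedOp (bracketCoeff E true) (toGraded E x) (toGraded E y) :=
  toGraded_extendOp E _ _ (fun _ _ => rfl) (fun _ _ => rfl) x y

theorem toGraded_mul (E : Finset (Bool × I × I)) (x y : FreeMagmatic I) :
    toGraded E (mul x y) = gradedOp (mulCoeff E) (toGraded E x) (toGraded E y) :=
  toGraded_extendOp E _ _ (fun _ _ => rfl) (fun _ _ => rfl) x y

/-- All the defining identities hold in the algebra attached to a graph. -/
theorem toGraded_relator (E : Finset (Bool × I × I)) {x : FreeMagmatic I} (h : IsRelator x) :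
    toGraded E x = 0 := by
  cases h with
  | skew₁ a b =>
    rw [map_add, toGraded_bracket₁, toGraded_bracket₁,
      gradedOp_swap (ε := -1) fun A B => by rw [bracketCoeff_skew]; ring]
    simp
  | skew₂ a b =>
    rw [map_add, toGraded_bracket₂, toGraded_bracket₂,
      gradedOp_swap (ε := -1) fun A B => by rw [bracketCoeff_skew]; ring]
    simp
  | comm a b =>
    rw [map_sub, toGraded_mul, toGraded_mul,
      gradedOp_swap (ε := 1) fun A B => by rw [mulCoeff_comm]; ring]
    simp
  | assoc a b c => simp only [map_sub, toGraded_mul, gradedOp_assoc]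
  | jacobi₁ a b c =>
    simp only [map_add, toGraded_bracket₁]
    exact gradedOp_jacobi E false _ _ _
  | jacobi₂ a b c =>
    simp only [map_add, toGraded_bracket₂]
    exact gradedOp_jacobi E true _ _ _
  | sixTerm a b c =>
    simp only [map_add, toGraded_bracket₁, toGraded_bracket₂]
    exact gradedOp_six E true false _ _ _
  | leibniz₁ a b c =>
    simp only [map_sub, map_add, toGraded_bracket₁, toGraded_mul]
    exact gradedOp_leibniz E false _ _ _
  | leibniz₂ a b c =>
    simp only [map_sub, map_add, toGraded_bracket₂, toGraded_mul]
    exact gradedOp_leibniz E true _ _ _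

/-- The pairing with a graph as a linear functional on the free algebra. -/
noncomputable def pairingFree (E : Finset (Bool × I × I)) : FreeMagmatic I →ₗ[ℚ] ℚ :=
  (Finsupp.linearCombination ℚ fun _ => (1 : ℚ)) ∘ₗ toGraded E

theorem relIdeal_le_ker (E : Finset (Bool × I × I)) :
    relIdeal I ≤ LinearMap.ker (pairingFree E) := by
  have h : relIdeal I ≤ LinearMap.ker (toGraded E) := by
    refine sInf_le ⟨⟨?_, ?_, ?_, ?_, ?_, ?_⟩, fun x hx => toGraded_relator E hx⟩ <;>
      intro x <;> intros <;>
      simp_all [toGraded_bracket₁, toGraded_bracket₂, toGraded_mul]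
  exact h.trans (LinearMap.ker_le_ker_comp _ _)

/-- The pairing with a graph as a linear functional on the free bi-Hamiltonian algebra. -/
noncomputable def pairingQuot (E : Finset (Bool × I × I)) : FreeBiHam I →ₗ[ℚ] ℚ :=
  (relIdeal I).liftQ (pairingFree E) (relIdeal_le_ker E)

theorem pairingQuot_eval (E : Finset (Bool × I × I)) (m : Mon I) :
    pairingQuot E m.eval = m.pairing E := by
  simp [pairingQuot, Mon.eval, pairingFree, toGraded]

end Pairing

/-! ### Pairings of multilinear monomials -/

section Forests

variable {I : Type*} [LinearOrder I]

theorem Mon.mem_leaves {b : Mon I} {i : I} : i ∈ b.leaves ↔ i ∈ b.supp := by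
  induction b <;> simp_all [Mon.leaves, Mon.supp]

theorem Mon.nodup_leaves_add {s t : Mon I} (h : (s.leaves + t.leaves).Nodup) :
    s.leaves.Nodup ∧ t.leaves.Nodup ∧ Disjoint s.supp t.supp := by
  obtain ⟨h1, h2, h3⟩ := Multiset.nodup_add.1 h
  refine ⟨h1, h2, Finset.disjoint_left.2 fun i hi hi' => ?_⟩
  exact Multiset.disjoint_left.1 h3 (Mon.mem_leaves.2 hi) (Mon.mem_leaves.2 hi')

open Classical in
theorem count_mul_count {A B : Multiset I} (hA : A.Nodup) (hB : B.Nodup) {A' B' : Finset I}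
    (hA' : ∀ i, i ∈ A ↔ i ∈ A') (hB' : ∀ i, i ∈ B ↔ i ∈ B') (i j : I) :
    A.count i * B.count j = if i ∈ A' ∧ j ∈ B' then 1 else 0 := by
  rw [Multiset.count_eq_of_nodup hA, Multiset.count_eq_of_nodup hB]
  simp only [hA', hB']
  split_ifs <;> simp_all

open Classical in
theorem crossings_eq_card {A B : Multiset I} (hA : A.Nodup) (hB : B.Nodup) {A' B' : Finset I}
    (hA' : ∀ i, i ∈ A ↔ i ∈ A') (hB' : ∀ i, i ∈ B ↔ i ∈ B') (hd : Disjoint A' B')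
    (E : Finset (Bool × I × I)) :
    crossings E A B = (E.filter fun e => Crosses e A' B').card := by
  rw [Finset.card_filter, crossings]
  refine Finset.sum_congr rfl fun e _ => ?_
  rw [count_mul_count hA hB hA' hB', count_mul_count hA hB hA' hB']
  have := Finset.disjoint_left.1 hd
  unfold Crosses
  split_ifs <;> first | rfl | (exfalso; grind)

theorem bracketCoeff_ne_zero_iff {A B : Multiset I} (hA : A.Nodup) (hB : B.Nodup)
    {A' B' : Finset I} (hA' : ∀ i, i ∈ A ↔ i ∈ A') (hB' : ∀ i, i ∈ B ↔ i ∈ B') (hd : Disjoint A' B')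
    (E : Finset (Bool × I × I)) (c : Bool) : bracketCoeff E c A B ≠ 0 ↔ CutBy E c A' B' := by
  classical
  have hd' := Finset.disjoint_left.1 hd
  have val : ∀ e : Bool × I × I, ((A.count e.2.1 : ℚ) * B.count e.2.2 -
      A.count e.2.2 * B.count e.2.1) ≠ 0 ↔ Crosses e A' B' := by
    intro e
    rw [← Nat.cast_mul, ← Nat.cast_mul, count_mul_count hA hB hA' hB',
      count_mul_count hA hB hA' hB']
    unfold Crosses
    split_ifs <;> simp <;> grind
  rw [bracketCoeff, crossings_eq_card hA hB hA' hB' hd]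
  constructor
  · intro h
    rw [ne_eq, ite_eq_right_iff, Classical.not_imp] at h
    obtain ⟨h1, h2⟩ := h
    obtain ⟨e, he⟩ := Finset.card_eq_one.1 h1
    have hu : ∀ e' ∈ E, Crosses e' A' B' → e' = e := fun e' h1 h2 => by
      have : e' ∈ ({e} : Finset _) := he ▸ Finset.mem_filter.2 ⟨h1, h2⟩
      simpa using this
    obtain ⟨x, hx, hx0⟩ := Finset.exists_ne_zero_of_sum_ne_zero h2
    rw [Finset.mem_filter] at hx
    have hx1 := (val x).1 hx0
    exact ⟨x, hx.1, hx.2, hx1, fun e' h1 h2 => (hu e' h1 h2).trans (hu x hx.1 hx1).symm⟩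
  · rintro ⟨e, he, hc, hx, hu⟩
    have h1 : (E.filter fun e => Crosses e A' B') = {e} := by
      ext e'
      simp only [Finset.mem_filter, Finset.mem_singleton]
      exact ⟨fun h => hu e' h.1 h.2, by rintro rfl; exact ⟨he, hx⟩⟩
    rw [h1, if_pos (Finset.card_singleton e), flow,
      Finset.sum_eq_single_of_mem e (Finset.mem_filter.2 ⟨he, hc⟩)]
    · exact (val e).2 hx
    · intro e' he' hne
      by_contra h
      exact hne (hu e' (Finset.mem_filter.1 he').1 ((val e').1 h))

theorem mulCoeff_ne_zero_iff {A B : Multiset I} (hA : A.Nodup) (hB : B.Nodup)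
    {A' B' : Finset I} (hA' : ∀ i, i ∈ A ↔ i ∈ A') (hB' : ∀ i, i ∈ B ↔ i ∈ B') (hd : Disjoint A' B')
    (E : Finset (Bool × I × I)) : mulCoeff E A B ≠ 0 ↔ ∀ e ∈ E, ¬ Crosses e A' B' := by
  classical
  rw [mulCoeff, crossings_eq_card hA hB hA' hB' hd]
  simp [Finset.filter_eq_empty_iff]

/-- The pairing of a multilinear monomial with a graph is nonzero exactly if the graph can be taken
apart along the monomial. -/
theorem Mon.pairing_ne_zero_iff {b : Mon I} (h : b.leaves.Nodup) (E : Finset (Bool × I × I)) :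
    b.pairing E ≠ 0 ↔ b.Cut E := by
  induction b with
  | gen i => simp [Mon.pairing, Mon.Cut]
  | br₁ s t ihs iht =>
    obtain ⟨h1, h2, h3⟩ := Mon.nodup_leaves_add h
    rw [Mon.pairing, mul_ne_zero_iff, mul_ne_zero_iff]
    exact and_congr (bracketCoeff_ne_zero_iff h1 h2 (fun _ => mem_leaves)
      (fun _ => mem_leaves) h3 _ _)
      (and_congr (ihs h1) (iht h2))
  | br₂ s t ihs iht =>
    obtain ⟨h1, h2, h3⟩ := Mon.nodup_leaves_add h
    rw [Mon.pairing, mul_ne_zero_iff, mul_ne_zero_iff]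
    exact and_congr (bracketCoeff_ne_zero_iff h1 h2 (fun _ => mem_leaves)
      (fun _ => mem_leaves) h3 _ _)
      (and_congr (ihs h1) (iht h2))
  | star s t ihs iht =>
    obtain ⟨h1, h2, h3⟩ := Mon.nodup_leaves_add h
    rw [Mon.pairing, mul_ne_zero_iff, mul_ne_zero_iff]
    exact and_congr (mulCoeff_ne_zero_iff h1 h2 (fun _ => mem_leaves) (fun _ => mem_leaves) h3 _)
      (and_congr (ihs h1) (iht h2))

/-! ### Products over set partitions -/

/-- `IsPartitionList A l` says that `l` lists, for some partition of `A`, members of the Lie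
families of the blocks, where the blocks come in the order of decreasing maxima. -/
inductive IsPartitionList : Finset I → List (Mon I) → Prop
  | nil : IsPartitionList ∅ []
  | cons {A A₁ A₂ : Finset I} {m : I} {c : Mon I} {l : List (Mon I)} (hd : Disjoint A₁ A₂)
      (hu : A₁ ∪ A₂ = A) (hm : IsGreatest (A : Set I) m) (hmA : m ∈ A₂) (hc : LieBasis A₂ c)
      (hl : IsPartitionList A₁ l) : IsPartitionList A (c :: l)

/-- The product `c_k ⋆ (⋯ ⋆ (c₁ ⋆ c₀))` of the monomial `c₀` and the list `[c₁, …, c_k]`. -/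
def starList : Mon I → List (Mon I) → Mon I
  | c, [] => c
  | c, d :: l => starList (.star d c) l

/-- The union of the graphs of the monomials of a list. -/
def listEdges : List (Mon I) → Finset (Bool × I × I)
  | [] => ∅
  | c :: l => c.edges ∪ listEdges l

/-- The condition on `E` to be taken apart along the product of a list of monomials. -/
def CutList (E : Finset (Bool × I × I)) : List (Mon I) → Prop
  | [] => True
  | c :: l => c.Cut E ∧ (∀ e ∈ E, ¬ Crosses e c.supp (csupp l)) ∧ CutList E l

theorem crosses_union_left {e : Bool × I × I} {A B C : Finset I} :
    Crosses e (A ∪ B) C ↔ Crosses e A C ∨ Crosses e B C := by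
  simp only [Crosses, Finset.mem_union]; tauto

theorem crosses_comm {e : Bool × I × I} {A B : Finset I} : Crosses e A B ↔ Crosses e B A :=
  ⟨Crosses.symm, Crosses.symm⟩

theorem cut_starList {E : Finset (Bool × I × I)} {c : Mon I} {l : List (Mon I)} :
    (starList c l).Cut E ↔ CutList E (c :: l) := by
  induction l generalizing c with
  | nil => simp [starList, CutList, csupp, Crosses]
  | cons d l ih =>
    rw [starList, ih]
    simp only [CutList, Mon.Cut, Mon.supp, csupp, crosses_union_left,
      crosses_comm (A := c.supp) (B := d.supp ∪ csupp l), crosses_comm (A := csupp l) (B := c.supp),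
      not_or]
    constructor
    · rintro ⟨⟨h1, h2, h3⟩, h4, h5⟩
      exact ⟨h3, fun e he => ⟨h1 e he, (h4 e he).2⟩, h2, fun e he => (h4 e he).1, h5⟩
    · rintro ⟨h3, h1, h2, h4, h5⟩
      exact ⟨⟨fun e he => (h1 e he).1, h2, h3⟩, fun e he => ⟨h4 e he, (h1 e he).2⟩, h5⟩

theorem leaves_starList (c : Mon I) (l : List (Mon I)) :
    (starList c l).leaves = c.leaves + (l.map Mon.leaves).sum := by
  induction l generalizing c with
  | nil => simp [starList]
  | cons d l ih =>
    rw [starList, ih, Mon.leaves, List.map_cons, List.sum_cons]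
    abel

theorem LieBasis.leaves_eq {A : Finset I} {b : Mon I} (h : LieBasis A b) : b.leaves = A.val := by
  induction h with
  | gen i => rfl
  | @br₁ A m i b' hm hi him hb' ih =>
    rw [Mon.leaves, ih, Mon.leaves, Finset.erase_val, Multiset.singleton_add,
      Multiset.cons_erase hi]
  | br₂ hd hu hm hm2 h1 h2 hf ih1 ih2 =>
    rw [Mon.leaves, ih1, ih2, ← hu, ← Finset.disjUnion_eq_union _ _ hd]
    rfl

theorem IsPartitionList.csupp_eq {A : Finset I} {l : List (Mon I)} (h : IsPartitionList A l) :
    csupp l = A := by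
  induction h with
  | nil => rfl
  | cons hd hu hm hmA hc hl ih => rw [csupp, ih, hc.supp_eq, Finset.union_comm, hu]

theorem IsPartitionList.leaves_eq {A : Finset I} {l : List (Mon I)} (h : IsPartitionList A l) :
    (l.map Mon.leaves).sum = A.val := by
  induction h with
  | nil => rfl
  | cons hd hu hm hmA hc hl ih =>
    rw [List.map_cons, List.sum_cons, ih, hc.leaves_eq, ← hu, add_comm,
      ← Finset.disjUnion_eq_union _ _ hd]
    rfl

theorem mem_csupp_of_mem_listEdges {l : List (Mon I)} {e : Bool × I × I} (h : e ∈ listEdges l) :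
    e.2.1 ∈ csupp l ∧ e.2.2 ∈ csupp l := by
  induction l with
  | nil => simp [listEdges] at h
  | cons c l ih =>
    simp only [csupp, Finset.mem_union]
    rcases Finset.mem_union.1 h with h | h
    · have := Mon.mem_supp_of_mem_edges h
      exact ⟨.inl this.1, .inl this.2⟩
    · exact ⟨.inr (ih h).1, .inr (ih h).2⟩

theorem CutList.congr {E E' : Finset (Bool × I × I)} {l : List (Mon I)}
    (h : ∀ e : Bool × I × I, e.2.1 ∈ csupp l → e.2.2 ∈ csupp l → (e ∈ E ↔ e ∈ E'))
    (hl : CutList E l) : CutList E' l := by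
  induction l with
  | nil => trivial
  | cons c l ih =>
    simp only [csupp] at h
    refine ⟨hl.1.congr fun e h1 h2 => h e (Finset.mem_union_left _ h1) (Finset.mem_union_left _ h2),
      fun e he hx => hl.2.1 e ((h e ?_ ?_).2 he) hx,
      ih (fun e h1 h2 => h e (Finset.mem_union_right _ h1) (Finset.mem_union_right _ h2)) hl.2.2⟩
      <;> unfold Crosses at hx <;> grind

/-- Restriction of the graph of a list of monomials with disjoint supports to the first one. -/
theorem mem_listEdges_left {c : Mon I} {l : List (Mon I)} (hd : Disjoint c.supp (csupp l))
    {e : Bool × I × I} (h : e.2.1 ∈ c.supp) : e ∈ listEdges (c :: l) ↔ e ∈ c.edges := by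
  simp only [listEdges, Finset.mem_union, or_iff_left_iff_imp]
  exact fun he => absurd (mem_csupp_of_mem_listEdges he).1 (Finset.disjoint_left.1 hd h)

theorem mem_listEdges_right {c : Mon I} {l : List (Mon I)} (hd : Disjoint c.supp (csupp l))
    {e : Bool × I × I} (h : e.2.1 ∈ csupp l) : e ∈ listEdges (c :: l) ↔ e ∈ listEdges l := by
  simp only [listEdges, Finset.mem_union, or_iff_right_iff_imp]
  exact fun he => absurd h (Finset.disjoint_left.1 hd (Mon.mem_supp_of_mem_edges he).1)

theorem IsPartitionList.cutList {A : Finset I} {l : List (Mon I)} (h : IsPartitionList A l) :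
    CutList (listEdges l) l := by
  induction h with
  | nil => trivial
  | @cons A A₁ A₂ m c l hd hu hm hmA hc hl ih =>
    have hd' : Disjoint c.supp (csupp l) := by rw [hc.supp_eq, hl.csupp_eq]; exact hd.symm
    refine ⟨hc.cut_edges.congr fun e h1 h2 => (mem_listEdges_left hd' h1).symm, fun e he hx => ?_,
      ih.congr fun e h1 h2 => (mem_listEdges_right hd' h1).symm⟩
    have hd1 := Finset.disjoint_left.1 hd'
    rcases Finset.mem_union.1 he with h | h
    · have := Mon.mem_supp_of_mem_edges h
      unfold Crosses at hx; grind
    · have := mem_csupp_of_mem_listEdges h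
      unfold Crosses at hx; grind

/-- The key of a list of monomials. -/
def listKey {n : ℕ} : List (Mon (Fin n)) → List ℕ
  | [] => []
  | c :: l => c.key ++ listKey l

/-- If the graph of a list can be taken apart along another list, the two partitions agree, since
their blocks are the connected components, and the keys can be compared blockwise. -/
theorem IsPartitionList.triangular {n : ℕ} {A : Finset (Fin n)} {l l' : List (Mon (Fin n))}
    (h : IsPartitionList A l) (h' : IsPartitionList A l') {E : Finset (Bool × Fin n × Fin n)}
    (hE : ∀ e : Bool × Fin n × Fin n, e.2.1 ∈ A → e.2.2 ∈ A → (e ∈ E ↔ e ∈ listEdges l))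
    (hcut : CutList E l') : l' = l ∨ LexLT (listKey l) (listKey l') := by
  induction h generalizing l' with
  | nil =>
    left
    cases h' with
    | nil => rfl
    | cons hd hu hm hmA hc hl => exact absurd hm.1 (by simp)
  | @cons A A₁ A₂ m c l hd hu hm hmA hc hl ih =>
    cases h' with
    | nil => exact absurd hm.1 (by simp)
    | @cons _ A₁' A₂' m' c' l' hd' hu' hm' hmA' hc' hl' =>
      obtain rfl : m = m' := hm.unique hm'
      have hds : Disjoint c.supp (csupp l) := by rw [hc.supp_eq, hl.csupp_eq]; exact hd.symm
      have hEc : ∀ e : Bool × Fin n × Fin n, e.2.1 ∈ A₂ → e.2.2 ∈ A₂ → (e ∈ E ↔ e ∈ c.edges) := by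
        intro e h1 h2
        rw [hE e (by grind) (by grind)]
        exact mem_listEdges_left hds (hc.supp_eq.symm ▸ h1)
      have hEl : ∀ e : Bool × Fin n × Fin n, e.2.1 ∈ A₁ → e.2.2 ∈ A₁ →
          (e ∈ E ↔ e ∈ listEdges l) := by
        intro e h1 h2
        rw [hE e (by grind) (by grind)]
        exact mem_listEdges_right hds (hl.csupp_eq.symm ▸ h1)
      have hd1 := Finset.disjoint_left.1 hd
      have hsub1 : A₂' ⊆ A₂ := by
        intro z hz
        by_contra hz2
        obtain ⟨e, he, hx⟩ := hc'.connected hcut.1 A₂ hmA' hmA hz hz2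
        have h12 : e.2.1 ∈ A ∧ e.2.2 ∈ A := by
          unfold Crosses at hx
          grind
        rcases Finset.mem_union.1 ((hE e h12.1 h12.2).1 he) with h | h
        · have := Mon.mem_supp_of_mem_edges h
          rw [hc.supp_eq] at this
          unfold Crosses at hx
          grind
        · have := mem_csupp_of_mem_listEdges h
          rw [hl.csupp_eq] at this
          unfold Crosses at hx
          grind
      have hsub2 : A₂ ⊆ A₂' := by
        intro z hz
        by_contra hz2
        have hcc : c.Cut E := hc.cut_edges.congr fun e h1 h2 => by
          rw [hc.supp_eq] at h1 h2
          exact (hEc e h1 h2).symm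
        obtain ⟨e, he, hx⟩ := hc.connected hcc A₂' hmA hmA' hz hz2
        refine hcut.2.1 e he ?_
        rw [hc'.supp_eq, hl'.csupp_eq]
        refine hx.mono Finset.inter_subset_right fun y hy => ?_
        have : y ∈ A₁' ∪ A₂' := by
          rw [hu', ← hu]
          exact Finset.mem_union_right _ (Finset.mem_sdiff.1 hy).1
        exact (Finset.mem_union.1 this).resolve_right (Finset.mem_sdiff.1 hy).2
      obtain rfl : A₂ = A₂' := hsub2.antisymm hsub1
      obtain rfl : A₁ = A₁' := by
        have hd1' := Finset.disjoint_left.1 hd'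
        have := hu.trans hu'.symm
        ext x
        have h3 := Finset.ext_iff.1 this x
        simp only [Finset.mem_union] at h3
        have := @hd1 x
        have := @hd1' x
        tauto
      rcases triangularBelow n _ A₂ c c' E (Nat.lt_succ_self _) hc hc' hEc hcut.1 with rfl | hlt
      · rcases ih hl' hEl hcut.2.2 with rfl | hlt
        · exact .inl rfl
        · exact .inr (hlt.append_left _)
      · exact .inr (hlt.append_right _ _)

/-- The products over partitions, as monomials. -/
def partitionMonomials (A : Finset I) : Set (Mon I) :=
  {b | ∃ c l, IsPartitionList A (c :: l) ∧ b = starList c l}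

/-- A vanishing combination is paired with the graph of the member of largest key among those with
nonzero coefficient: all the other terms pair to zero with this graph. -/
theorem linearIndependent_partitionMonomials {n : ℕ} (A : Finset (Fin n)) :
    LinearIndependent ℚ fun b : partitionMonomials A => b.1.eval := by
  choose c l hl hb using fun b : partitionMonomials A => b.2
  rw [linearIndependent_iff']
  intro s g hg
  by_contra! hne
  obtain ⟨i, his, hi⟩ := hne
  obtain ⟨b, hbs, hmax⟩ := Finset.exists_max_image (s.filter fun i => g i ≠ 0)
    (fun b => listKey (c b :: l b)) ⟨i, Finset.mem_filter.2 ⟨his, hi⟩⟩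
  rw [Finset.mem_filter] at hbs
  have nodup : ∀ b : partitionMonomials A, b.1.leaves.Nodup := fun b => by
    rw [hb b, leaves_starList]
    have := (hl b).leaves_eq
    rw [List.map_cons, List.sum_cons] at this
    rw [this]
    exact A.nodup
  have h0 := congrArg (pairingQuot (listEdges (c b :: l b))) hg
  rw [map_sum, map_zero, Finset.sum_eq_single_of_mem b hbs.1] at h0
  · rw [map_smul, pairingQuot_eval, smul_eq_mul, mul_eq_zero] at h0
    refine (Mon.pairing_ne_zero_iff (nodup b) _).2 ?_ (h0.resolve_left hbs.2)
    rw [hb b, cut_starList]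
    exact (hl b).cutList
  · intro b' hb' hne
    rw [map_smul, pairingQuot_eval, smul_eq_mul, mul_eq_zero]
    by_contra! hcon
    have hcut := (Mon.pairing_ne_zero_iff (nodup b') _).1 hcon.2
    rw [hb b', cut_starList] at hcut
    rcases (hl b).triangular (hl b') (fun e _ _ => Iff.rfl) hcut with h | h
    · obtain ⟨h1, h2⟩ := List.cons.inj h
      exact hne (Subtype.ext (by rw [hb b', hb b, h1, h2]))
    · exact absurd h.lt (not_lt.2 (hmax b' (Finset.mem_filter.2 ⟨hb', hcon.1⟩)))

end Forests

/-! ### Operations on the free bi-Hamiltonian algebra -/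

section Quotient

variable {I : Type*}

theorem isIdeal_relIdeal : IsIdeal (relIdeal I) := by
  constructor <;> intro x <;> intros <;> simp only [relIdeal, Submodule.mem_sInf] at * <;>
    intro J hJ
  · exact hJ.1.bracket₁_right _ _ (by simp_all)
  · exact hJ.1.bracket₁_left _ (by simp_all) _
  · exact hJ.1.bracket₂_right _ _ (by simp_all)
  · exact hJ.1.bracket₂_left _ (by simp_all) _
  · exact hJ.1.mul_right _ _ (by simp_all)
  · exact hJ.1.mul_left _ (by simp_all) _

theorem IsRelator.mem_relIdeal {x : FreeMagmatic I} (h : IsRelator x) : x ∈ relIdeal I := by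
  simp only [relIdeal, Submodule.mem_sInf]
  exact fun J hJ => hJ.2 x h

/-- The operation on the quotient by a two-sided ideal that is induced by a bilinear operation. -/
noncomputable def quotientOp (J : Submodule ℚ (FreeMagmatic I))
    (f : FreeMagmatic I →ₗ[ℚ] FreeMagmatic I →ₗ[ℚ] FreeMagmatic I)
    (hr : ∀ x, ∀ y ∈ J, f x y ∈ J) (hl : ∀ x ∈ J, ∀ y, f x y ∈ J) :
    (FreeMagmatic I ⧸ J) →ₗ[ℚ] (FreeMagmatic I ⧸ J) →ₗ[ℚ] (FreeMagmatic I ⧸ J) :=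
  J.liftQ
    { toFun := fun x => J.mapQ J (f x) (hr x)
      map_add' := fun x y => by ext; simp
      map_smul' := fun c x => by ext; simp }
    fun x hx => by
      rw [LinearMap.mem_ker]
      ext y
      simpa using (Submodule.Quotient.mk_eq_zero J).2 (hl x hx _)

/-- The brackets of the free bi-Hamiltonian algebra, the first one for `false`, the second one for
`true`. -/
noncomputable def qbr (c : Bool) : FreeBiHam I →ₗ[ℚ] FreeBiHam I →ₗ[ℚ] FreeBiHam I :=
  match c with
  | false => quotientOp _ bracket₁ isIdeal_relIdeal.bracket₁_right isIdeal_relIdeal.bracket₁_left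
  | true => quotientOp _ bracket₂ isIdeal_relIdeal.bracket₂_right isIdeal_relIdeal.bracket₂_left

/-- The product of the free bi-Hamiltonian algebra. -/
noncomputable def qmul : FreeBiHam I →ₗ[ℚ] FreeBiHam I →ₗ[ℚ] FreeBiHam I :=
  quotientOp _ mul isIdeal_relIdeal.mul_right isIdeal_relIdeal.mul_left

theorem qbr_false_mk (x y : FreeMagmatic I) :
    qbr false ((relIdeal I).mkQ x) ((relIdeal I).mkQ y) = (relIdeal I).mkQ (bracket₁ x y) := rfl

theorem qbr_true_mk (x y : FreeMagmatic I) :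
    qbr true ((relIdeal I).mkQ x) ((relIdeal I).mkQ y) = (relIdeal I).mkQ (bracket₂ x y) := rfl

theorem qmul_mk (x y : FreeMagmatic I) :
    qmul ((relIdeal I).mkQ x) ((relIdeal I).mkQ y) = (relIdeal I).mkQ (mul x y) := rfl

theorem eval_br₁ (s t : Mon I) : (Mon.br₁ s t).eval = qbr false s.eval t.eval := by
  rw [Mon.eval, Mon.eval, Mon.eval, qbr_false_mk, bracket₁, extendOp_single, mul_one]

theorem eval_br₂ (s t : Mon I) : (Mon.br₂ s t).eval = qbr true s.eval t.eval := by
  rw [Mon.eval, Mon.eval, Mon.eval, qbr_true_mk, bracket₂, extendOp_single, mul_one]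

theorem eval_star (s t : Mon I) : (Mon.star s t).eval = qmul s.eval t.eval := by
  rw [Mon.eval, Mon.eval, Mon.eval, qmul_mk, mul, extendOp_single, mul_one]

theorem mkQ_relator {x : FreeMagmatic I} (h : IsRelator x) : (relIdeal I).mkQ x = 0 := by
  simpa using h.mem_relIdeal

theorem qbr_skew (c : Bool) (a b : FreeBiHam I) : qbr c a b = - qbr c b a := by
  obtain ⟨a, rfl⟩ := (relIdeal I).mkQ_surjective a
  obtain ⟨b, rfl⟩ := (relIdeal I).mkQ_surjective b
  rw [eq_neg_iff_add_eq_zero]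
  cases c
  · exact mkQ_relator (.skew₁ a b)
  · exact mkQ_relator (.skew₂ a b)

theorem qbr_jacobi (c : Bool) (a b z : FreeBiHam I) :
    qbr c (qbr c a b) z = qbr c a (qbr c b z) - qbr c b (qbr c a z) := by
  have h : qbr c a (qbr c b z) + qbr c b (qbr c z a) + qbr c z (qbr c a b) = 0 := by
    obtain ⟨a, rfl⟩ := (relIdeal I).mkQ_surjective a
    obtain ⟨b, rfl⟩ := (relIdeal I).mkQ_surjective b
    obtain ⟨z, rfl⟩ := (relIdeal I).mkQ_surjective z
    cases c
    · exact mkQ_relator (.jacobi₁ a b z)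
    · exact mkQ_relator (.jacobi₂ a b z)
  rw [qbr_skew c z a, qbr_skew c z (qbr c a b), map_neg] at h
  rw [← sub_eq_zero, ← neg_eq_zero, ← h]
  abel

theorem qbr_six (a b z : FreeBiHam I) :
    qbr false (qbr true a b) z =
      qbr true a (qbr false b z) - qbr true b (qbr false a z) - qbr true (qbr false a b) z +
        (qbr false a (qbr true b z) - qbr false b (qbr true a z)) := by
  have h : qbr true a (qbr false b z) + qbr true b (qbr false z a) + qbr true z (qbr false a b) +
      qbr false a (qbr true b z) + qbr false b (qbr true z a) + qbr false z (qbr true a b) = 0 := by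
    obtain ⟨a, rfl⟩ := (relIdeal I).mkQ_surjective a
    obtain ⟨b, rfl⟩ := (relIdeal I).mkQ_surjective b
    obtain ⟨z, rfl⟩ := (relIdeal I).mkQ_surjective z
    exact mkQ_relator (.sixTerm a b z)
  rw [qbr_skew _ z a, qbr_skew _ z a, qbr_skew _ z (qbr _ a b), qbr_skew _ z (qbr _ a b),
    map_neg, map_neg] at h
  rw [← sub_eq_zero, ← neg_eq_zero, ← h]
  abel

theorem qmul_comm (a b : FreeBiHam I) : qmul a b = qmul b a := by
  obtain ⟨a, rfl⟩ := (relIdeal I).mkQ_surjective a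
  obtain ⟨b, rfl⟩ := (relIdeal I).mkQ_surjective b
  rw [← sub_eq_zero]
  exact mkQ_relator (.comm a b)

theorem qmul_assoc (a b z : FreeBiHam I) : qmul (qmul a b) z = qmul a (qmul b z) := by
  obtain ⟨a, rfl⟩ := (relIdeal I).mkQ_surjective a
  obtain ⟨b, rfl⟩ := (relIdeal I).mkQ_surjective b
  obtain ⟨z, rfl⟩ := (relIdeal I).mkQ_surjective z
  rw [← sub_eq_zero]
  exact mkQ_relator (.assoc a b z)

theorem qmul_left_comm (a b z : FreeBiHam I) : qmul a (qmul b z) = qmul b (qmul a z) := by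
  rw [← qmul_assoc, qmul_comm a b, qmul_assoc]

theorem qbr_leibniz (c : Bool) (a b z : FreeBiHam I) :
    qbr c a (qmul b z) = qmul (qbr c a b) z + qmul b (qbr c a z) := by
  obtain ⟨a, rfl⟩ := (relIdeal I).mkQ_surjective a
  obtain ⟨b, rfl⟩ := (relIdeal I).mkQ_surjective b
  obtain ⟨z, rfl⟩ := (relIdeal I).mkQ_surjective z
  rw [← sub_eq_zero]
  cases c
  · exact mkQ_relator (.leibniz₁ a b z)
  · exact mkQ_relator (.leibniz₂ a b z)

end Quotient

/-! ### Rewriting into products of Lie monomials -/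

section Spanning

/-- A bilinear map sends two spans into a submodule if it does so with the generators. -/
theorem apply_mem_of_mem_span {M N P : Type*} [AddCommGroup M] [Module ℚ M] [AddCommGroup N]
    [Module ℚ N] [AddCommGroup P] [Module ℚ P] (f : M →ₗ[ℚ] N →ₗ[ℚ] P) {s : Set M} {t : Set N}
    {W : Submodule ℚ P} (h : ∀ x ∈ s, ∀ y ∈ t, f x y ∈ W) {x : M} {y : N}
    (hx : x ∈ Submodule.span ℚ s) (hy : y ∈ Submodule.span ℚ t) : f x y ∈ W := by
  have h1 : Submodule.map₂ f (Submodule.span ℚ s) (Submodule.span ℚ t) ≤ W := by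
    rw [Submodule.map₂_span_span, Submodule.span_le]
    rintro _ ⟨x, hx, y, hy, rfl⟩
    exact h x hx y hy
  exact h1 (Submodule.apply_mem_map₂ f hx hy)

variable {I : Type*} [LinearOrder I]

/-- The span of the values of the monomials of the family `𝔅(A)`. -/
noncomputable def lieSpan (A : Finset I) : Submodule ℚ (FreeBiHam I) :=
  Submodule.span ℚ (Mon.eval '' {b | LieBasis A b})

theorem LieBasis.eval_mem {A : Finset I} {b : Mon I} (h : LieBasis A b) : b.eval ∈ lieSpan A :=
  Submodule.subset_span ⟨b, h, rfl⟩

theorem isGreatest_union_of_subset {A B A' : Finset I} {m : I}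
    (hm : IsGreatest ((A ∪ B : Finset I) : Set I) m) (hmB : m ∈ B) (h : A' ⊆ A) :
    IsGreatest ((A' ∪ B : Finset I) : Set I) m :=
  ⟨Finset.mem_coe.2 (Finset.mem_union_right _ hmB), fun _ hx => hm.2
    (Finset.mem_coe.2 (Finset.union_subset_union_left h (Finset.mem_coe.1 hx)))⟩

/-- Rewriting of a bracket of two Lie monomials the second of which contains the maximum. The
induction is on the size of the first argument `a`. If `a` is itself a bracket, the Jacobi identity
or the six-term identity makes its two arguments act one after the other; the only term of a
different kind, `{{a₁, a₂}₁, b}₂`, is dealt with by the case of the second bracket. -/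
theorem qbr_mem_lieSpan_of_isGreatest (N : ℕ) : ∀ (A B : Finset I) (m : I), A.card ≤ N →
    Disjoint A B → IsGreatest ((A ∪ B : Finset I) : Set I) m → m ∈ B → ∀ (c : Bool),
    ∀ x ∈ lieSpan A, ∀ y ∈ lieSpan B, qbr c x y ∈ lieSpan (A ∪ B) := by
  induction N with
  | zero =>
    intro A B m hA hd hm hmB c x hx y hy
    refine apply_mem_of_mem_span _ ?_ hx hy
    rintro _ ⟨a, ha, rfl⟩
    have := a.first_mem
    rw [ha.supp_eq, Finset.card_eq_zero.1 (Nat.le_zero.1 hA)] at this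
    simp at this
  | succ N ih =>
    intro A B m hA hd hm hmB
    -- The arguments `x` and `y` of the first argument act on `z` one after the other.
    have two : ∀ (A₁ A₂ : Finset I), Disjoint A₁ A₂ → A₁ ∪ A₂ = A → A₁.Nonempty → A₂.Nonempty →
        ∀ (c d : Bool), ∀ x ∈ lieSpan A₁, ∀ y ∈ lieSpan A₂, ∀ z ∈ lieSpan B,
        qbr c x (qbr d y z) ∈ lieSpan (A ∪ B) ∧ qbr c y (qbr d x z) ∈ lieSpan (A ∪ B) := by
      have one : ∀ (A₁ A₂ : Finset I), Disjoint A₁ A₂ → A₁ ∪ A₂ = A → A₁.Nonempty → A₂.Nonempty →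
          ∀ (c d : Bool), ∀ x ∈ lieSpan A₁, ∀ y ∈ lieSpan A₂, ∀ z ∈ lieSpan B,
          qbr c x (qbr d y z) ∈ lieSpan (A ∪ B) := by
        intro A₁ A₂ hd12 hu hn1 hn2 c d x hx y hy z hz
        have hcard := Finset.card_union_of_disjoint hd12
        rw [hu] at hcard
        have h1 := hn1.card_pos
        have h2 := hn2.card_pos
        rw [← hu, Finset.disjoint_union_left] at hd
        have hyz := ih A₂ B m (by omega) hd.2
          (isGreatest_union_of_subset hm hmB (hu ▸ Finset.subset_union_right)) hmB d y hy z hz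
        have := ih A₁ (A₂ ∪ B) m (by omega) (Finset.disjoint_union_right.2 ⟨hd12, hd.1⟩)
          (by rw [← Finset.union_assoc, hu]; exact hm) (Finset.mem_union_right _ hmB) c x hx _ hyz
        rwa [← Finset.union_assoc, hu] at this
      intro A₁ A₂ hd12 hu hn1 hn2 c d x hx y hy z hz
      exact ⟨one A₁ A₂ hd12 hu hn1 hn2 c d x hx y hy z hz,
        one A₂ A₁ hd12.symm (by rw [Finset.union_comm, hu]) hn2 hn1 c d y hy x hx z hz⟩
    have htrue : ∀ x ∈ lieSpan A, ∀ y ∈ lieSpan B, qbr true x y ∈ lieSpan (A ∪ B) := by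
      intro x hx y hy
      refine apply_mem_of_mem_span _ ?_ hx hy
      rintro _ ⟨a, ha, rfl⟩ _ ⟨b, hb, rfl⟩
      have block : a.IsBlock → qbr true a.eval b.eval ∈ lieSpan (A ∪ B) := fun h => by
        rw [← eval_br₂]
        exact (LieBasis.br₂ hd rfl hm hmB ha hb h).eval_mem
      cases a with
      | gen i => exact block (.inl ⟨i, rfl⟩)
      | br₁ s t => exact block (.inr ⟨s, t, rfl⟩)
      | br₂ s t =>
        obtain ⟨h1, h2, h3, h4, -⟩ := LieBasis.inv_br₂ ha
        have := two s.supp t.supp h1 h2 ⟨_, s.first_mem⟩ ⟨_, t.first_mem⟩ true true _ h3.eval_mem _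
          h4.eval_mem _ hb.eval_mem
        rw [eval_br₂, qbr_jacobi]
        exact sub_mem this.1 this.2
      | star s t => cases ha
    have hfalse : ∀ x ∈ lieSpan A, ∀ y ∈ lieSpan B, qbr false x y ∈ lieSpan (A ∪ B) := by
      intro x hx y hy
      refine apply_mem_of_mem_span _ ?_ hx hy
      rintro _ ⟨a, ha, rfl⟩ _ ⟨b, hb, rfl⟩
      cases a with
      | gen i =>
        cases ha
        rw [← eval_br₁]
        rw [Finset.disjoint_singleton_left] at hd
        refine (LieBasis.br₁ hm (by simp) (lt_of_le_of_ne (hm.2 (by simp)) ?_) ?_).eval_mem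
        · rintro rfl
          exact hd hmB
        · rw [← Finset.insert_eq, Finset.erase_insert hd]
          exact hb
      | br₁ s t =>
        have hdt := LieBasis.disjoint_br₁ ha
        have hst := LieBasis.supp_eq ha
        obtain ⟨i, rfl, hi, -, ht⟩ := LieBasis.inv_br₁ ha
        have := two {i} t.supp hdt hst ⟨i, by simp⟩ ⟨_, t.first_mem⟩ false false _
          (LieBasis.gen i).eval_mem _ ht.self.eval_mem _ hb.eval_mem
        rw [eval_br₁, qbr_jacobi]
        exact sub_mem this.1 this.2
      | br₂ s t =>
        obtain ⟨h1, h2, h3, h4, -⟩ := LieBasis.inv_br₂ ha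
        have hn1 : s.supp.Nonempty := ⟨_, s.first_mem⟩
        have hn2 : t.supp.Nonempty := ⟨_, t.first_mem⟩
        have q1 := two s.supp t.supp h1 h2 hn1 hn2 true false _ h3.eval_mem _
          h4.eval_mem _ hb.eval_mem
        have q2 := two s.supp t.supp h1 h2 hn1 hn2 false true _ h3.eval_mem _
          h4.eval_mem _ hb.eval_mem
        have hcard := Finset.card_union_of_disjoint h1
        rw [h2] at hcard
        have := hn2.card_pos
        have hA' := (LieBasis.isGreatest_tip ha)
        rw [← h2] at hA'
        have q3 := ih s.supp t.supp _ (by omega) h1 hA' t.tip_mem false _ h3.eval_mem _ h4.eval_mem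
        rw [h2] at q3
        rw [eval_br₂, qbr_six]
        exact add_mem (sub_mem (sub_mem q1.1 q1.2) (htrue _ q3 _ hb.eval_mem)) (sub_mem q2.1 q2.2)
      | star s t => cases ha
    intro c
    cases c
    · exact hfalse
    · exact htrue

theorem qbr_mem_lieSpan {A B : Finset I} (hd : Disjoint A B) (c : Bool) {x y : FreeBiHam I}
    (hx : x ∈ lieSpan A) (hy : y ∈ lieSpan B) : qbr c x y ∈ lieSpan (A ∪ B) := by
  rcases (A ∪ B).eq_empty_or_nonempty with h | h
  · refine apply_mem_of_mem_span _ ?_ hx hy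
    rintro _ ⟨a, ha, rfl⟩
    have := a.first_mem
    rw [ha.supp_eq, (Finset.union_eq_empty.1 h).1] at this
    simp at this
  · obtain ⟨m, hm⟩ : ∃ m, IsGreatest ((A ∪ B : Finset I) : Set I) m :=
      ⟨_, (A ∪ B).isGreatest_max' h⟩
    rcases Finset.mem_union.1 (Finset.mem_coe.1 hm.1) with hmA | hmB
    · rw [qbr_skew, Finset.union_comm]
      rw [Finset.union_comm] at hm
      exact neg_mem (qbr_mem_lieSpan_of_isGreatest _ B A _ le_rfl hd.symm hm
        hmA c y hy x hx)
    · exact qbr_mem_lieSpan_of_isGreatest _ A B _ le_rfl hd hm hmB c x hx y hy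

/-- The products of values of Lie monomials over the blocks of a partition of `A`, where the blocks
come in the order of decreasing maxima. -/
inductive IsProductOver : Finset I → FreeBiHam I → Prop
  | base {A : Finset I} {c : Mon I} (hc : LieBasis A c) : IsProductOver A c.eval
  | cons {A A₁ A₂ : Finset I} {m : I} {c : Mon I} {x : FreeBiHam I} (hd : Disjoint A₁ A₂)
      (hu : A₁ ∪ A₂ = A) (hm : IsGreatest (A : Set I) m) (hmA : m ∈ A₂) (hc : LieBasis A₂ c)
      (hx : IsProductOver A₁ x) : IsProductOver A (qmul c.eval x)

theorem eval_starList_star (c d : Mon I) (l : List (Mon I)) :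
    (starList (.star d c) l).eval = qmul c.eval (starList d l).eval := by
  induction l generalizing c d with
  | nil => rw [starList, starList, eval_star, qmul_comm]
  | cons e l ih =>
    rw [starList, starList, ih, ih, eval_star, qmul_comm d.eval, qmul_assoc]

theorem IsProductOver.exists_monomial {A : Finset I} {x : FreeBiHam I} (h : IsProductOver A x) :
    ∃ b ∈ partitionMonomials A, x = b.eval := by
  induction h with
  | @base A c hc =>
    exact ⟨c, ⟨c, [], .cons (A₁ := ∅) (by simp) (by simp) hc.isGreatest_tip hc.isGreatest_tip.1 hc
      .nil, rfl⟩, rfl⟩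
  | cons hd hu hm hmA hc hx ih =>
    obtain ⟨_, ⟨d, l, hl, rfl⟩, rfl⟩ := ih
    exact ⟨_, ⟨_, _, .cons hd hu hm hmA hc hl, rfl⟩, (eval_starList_star _ _ _).symm⟩

/-- The span of the products over partitions of `A`. -/
noncomputable def productSpan (A : Finset I) : Submodule ℚ (FreeBiHam I) :=
  Submodule.span ℚ {x | IsProductOver A x}

theorem lieSpan_le_productSpan (A : Finset I) : lieSpan A ≤ productSpan A := by
  refine Submodule.span_le.2 ?_
  rintro _ ⟨b, hb, rfl⟩
  exact Submodule.subset_span (.base hb)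

/-- Multiplication by the factor that contains the maximum. -/
theorem qmul_mem_productSpan_of_isGreatest {A A₁ A₂ : Finset I} {m : I} {c : Mon I}
    {x : FreeBiHam I} (hd : Disjoint A₁ A₂) (hu : A₁ ∪ A₂ = A) (hm : IsGreatest (A : Set I) m)
    (hmA : m ∈ A₂) (hc : LieBasis A₂ c) (hx : x ∈ productSpan A₁) :
    qmul c.eval x ∈ productSpan A := by
  have : productSpan A₁ ≤ (productSpan A).comap (qmul c.eval) :=
    Submodule.span_le.2 fun y hy => Submodule.subset_span (.cons hd hu hm hmA hc hy)
  exact this hx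

/-- Insertion of one more factor into a product whose factors are sorted by their maxima. -/
theorem LieBasis.qmul_mem_productSpan {A B : Finset I} {c : Mon I} {x : FreeBiHam I}
    (hc : LieBasis A c) (hx : IsProductOver B x) (hd : Disjoint A B) :
    qmul c.eval x ∈ productSpan (A ∪ B) := by
  obtain ⟨m, hm⟩ : ∃ m, IsGreatest ((A ∪ B : Finset I) : Set I) m :=
    ⟨_, (A ∪ B).isGreatest_max' ⟨_, Finset.mem_union_left _ (hc.supp_eq ▸ c.first_mem)⟩⟩
  induction hx generalizing m with
  | @base B b hb =>
    rcases Finset.mem_union.1 (Finset.mem_coe.1 hm.1) with hmA | hmB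
    · exact qmul_mem_productSpan_of_isGreatest hd.symm (Finset.union_comm _ _) hm hmA hc
        (Submodule.subset_span (.base hb))
    · rw [qmul_comm]
      exact qmul_mem_productSpan_of_isGreatest hd rfl hm hmB hb
        (lieSpan_le_productSpan _ hc.eval_mem)
  | @cons B B₁ B₂ k d x hd' hu hk hkB hdB hx ih =>
    rcases Finset.mem_union.1 (Finset.mem_coe.1 hm.1) with hmA | hmB
    · exact qmul_mem_productSpan_of_isGreatest hd.symm (Finset.union_comm _ _) hm hmA hc
        (Submodule.subset_span (.cons hd' hu hk hkB hdB hx))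
    · obtain rfl : k = m := le_antisymm (hm.2 (Finset.mem_union_right _ hk.1)) (hk.2 hmB)
      subst hu
      rw [Finset.disjoint_union_right] at hd
      rw [qmul_left_comm]
      refine qmul_mem_productSpan_of_isGreatest (Finset.disjoint_union_left.2 ⟨hd.2, hd'⟩)
        (Finset.union_assoc _ _ _) hm hkB hdB ?_
      exact ih hd.1 _ ((A ∪ B₁).isGreatest_max'
        ⟨_, Finset.mem_union_left _ (hc.supp_eq ▸ c.first_mem)⟩)

theorem qmul_mem_productSpan_of_mem_lieSpan {A B : Finset I} (hd : Disjoint A B)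
    {x y : FreeBiHam I} (hx : x ∈ lieSpan A) (hy : y ∈ productSpan B) :
    qmul x y ∈ productSpan (A ∪ B) := by
  refine apply_mem_of_mem_span _ ?_ hx hy
  rintro _ ⟨a, ha, rfl⟩ y hy
  exact LieBasis.qmul_mem_productSpan ha hy hd

theorem qmul_mem_productSpan {A B : Finset I} (hd : Disjoint A B) {x y : FreeBiHam I}
    (hx : x ∈ productSpan A) (hy : y ∈ productSpan B) : qmul x y ∈ productSpan (A ∪ B) := by
  have gen : ∀ x, IsProductOver A x → qmul x y ∈ productSpan (A ∪ B) := by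
    clear hx
    intro x hx
    induction hx with
    | base hc => exact qmul_mem_productSpan_of_mem_lieSpan hd hc.eval_mem hy
    | @cons A A₁ A₂ m c x hd' hu hm hmA hc hx ih =>
      subst hu
      rw [Finset.disjoint_union_left] at hd
      rw [qmul_assoc, Finset.union_comm A₁, Finset.union_assoc]
      exact qmul_mem_productSpan_of_mem_lieSpan (Finset.disjoint_union_right.2 ⟨hd'.symm, hd.2⟩)
        hc.eval_mem (ih hd.1)
  have : productSpan A ≤ (productSpan (A ∪ B)).comap (qmul.flip y) := Submodule.span_le.2 gen
  exact this hx

theorem qbr_mem_productSpan_of_mem_lieSpan {A B : Finset I} (hd : Disjoint A B) (e : Bool)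
    {x y : FreeBiHam I} (hx : x ∈ lieSpan A) (hy : y ∈ productSpan B) :
    qbr e x y ∈ productSpan (A ∪ B) := by
  have gen : ∀ y, IsProductOver B y → qbr e x y ∈ productSpan (A ∪ B) := by
    clear hy
    intro y hy
    induction hy with
    | base hc => exact lieSpan_le_productSpan _ (qbr_mem_lieSpan hd e hx hc.eval_mem)
    | @cons B B₁ B₂ m c y hd' hu hm hmB hc hy ih =>
      subst hu
      rw [Finset.disjoint_union_right] at hd
      rw [qbr_leibniz]
      refine add_mem ?_ ?_
      · rw [Finset.union_comm B₁, ← Finset.union_assoc]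
        exact qmul_mem_productSpan_of_mem_lieSpan (Finset.disjoint_union_left.2 ⟨hd.1, hd'.symm⟩)
          (qbr_mem_lieSpan hd.2 e hx hc.eval_mem) (Submodule.subset_span hy)
      · rw [Finset.union_comm B₁, Finset.union_left_comm]
        exact qmul_mem_productSpan_of_mem_lieSpan (Finset.disjoint_union_right.2 ⟨hd.2.symm,
          hd'.symm⟩) hc.eval_mem (ih hd.1)
  have : productSpan B ≤ (productSpan (A ∪ B)).comap (qbr e x) := Submodule.span_le.2 gen
  exact this hy

theorem qbr_mem_productSpan {A B : Finset I} (hd : Disjoint A B) (e : Bool) {x y : FreeBiHam I}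
    (hx : x ∈ productSpan A) (hy : y ∈ productSpan B) : qbr e x y ∈ productSpan (A ∪ B) := by
  have gen : ∀ x, IsProductOver A x → qbr e x y ∈ productSpan (A ∪ B) := by
    clear hx
    intro x hx
    induction hx with
    | base hc => exact qbr_mem_productSpan_of_mem_lieSpan hd e hc.eval_mem hy
    | @cons A A₁ A₂ m c x hd' hu hm hmA hc hx ih =>
      subst hu
      rw [Finset.disjoint_union_left] at hd
      rw [qbr_skew, qbr_leibniz, qbr_skew e y, qbr_skew e y, map_neg, map_neg,
        LinearMap.neg_apply]
      refine neg_mem (add_mem (neg_mem ?_) (neg_mem ?_))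
      · rw [qmul_comm, Finset.union_assoc]
        exact qmul_mem_productSpan (Finset.disjoint_union_right.2 ⟨hd', hd.1⟩)
          (Submodule.subset_span hx) (qbr_mem_productSpan_of_mem_lieSpan hd.2 e hc.eval_mem hy)
      · rw [Finset.union_comm A₁, Finset.union_assoc]
        exact qmul_mem_productSpan_of_mem_lieSpan (Finset.disjoint_union_right.2 ⟨hd'.symm, hd.2⟩)
          hc.eval_mem (ih hd.1)
  have : productSpan A ≤ (productSpan (A ∪ B)).comap ((qbr e).flip y) := Submodule.span_le.2 gen
  exact this hx

/-- Every multilinear monomial is a combination of products of Lie monomials over partitions. -/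
theorem Mon.eval_mem_productSpan {b : Mon I} (h : b.leaves.Nodup) :
    b.eval ∈ productSpan b.supp := by
  induction b with
  | gen i => exact Submodule.subset_span (.base (.gen i))
  | br₁ s t ihs iht =>
    obtain ⟨h1, h2, h3⟩ := Mon.nodup_leaves_add h
    rw [eval_br₁]
    exact qbr_mem_productSpan h3 _ (ihs h1) (iht h2)
  | br₂ s t ihs iht =>
    obtain ⟨h1, h2, h3⟩ := Mon.nodup_leaves_add h
    rw [eval_br₂]
    exact qbr_mem_productSpan h3 _ (ihs h1) (iht h2)
  | star s t ihs iht =>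
    obtain ⟨h1, h2, h3⟩ := Mon.nodup_leaves_add h
    rw [eval_star]
    exact qmul_mem_productSpan h3 (ihs h1) (iht h2)

theorem leaves_of_mem_partitionMonomials {A : Finset I} {b : Mon I}
    (h : b ∈ partitionMonomials A) : b.leaves = A.val := by
  obtain ⟨c, l, hl, rfl⟩ := h
  rw [leaves_starList, ← List.sum_cons, ← List.map_cons, hl.leaves_eq]

/-- The products over partitions span the multilinear component. -/
theorem P₂_eq_span {I : Type*} [LinearOrder I] [Fintype I] :
    P₂ I = Submodule.span ℚ (Mon.eval '' partitionMonomials (Finset.univ : Finset I)) := by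
  refine le_antisymm (Submodule.span_le.2 ?_) (Submodule.span_mono (Set.image_mono fun b hb =>
    leaves_of_mem_partitionMonomials hb))
  rintro _ ⟨b, hb, rfl⟩
  have hs : b.supp = Finset.univ := by
    ext i
    rw [← Mon.mem_leaves, show b.leaves = _ from hb]
    simp
  have h := Mon.eval_mem_productSpan (b := b) (by
    rw [show b.leaves = _ from hb]; exact Finset.nodup _)
  rw [hs] at h
  refine Submodule.span_mono ?_ h
  intro x hx
  obtain ⟨b, hb, rfl⟩ := IsProductOver.exists_monomial hx
  exact ⟨b, hb, rfl⟩

end Spanning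

/-! ### Abel's binomial identity -/

section Abel

open Polynomial in
/-- The difference of the two sides of Abel's binomial identity, as a polynomial in `y`. -/
noncomputable def abelPoly (x : ℚ) (n : ℕ) : ℚ[X] :=
  X ^ n + ∑ k ∈ Finset.range n,
    C (n.choose (k + 1) * x * (x + k + 1) ^ k) * (X - C ((k : ℚ) + 1)) ^ (n - (k + 1)) -
      (X + C x) ^ n

open Polynomial in
theorem derivative_abelPoly (x : ℚ) (n : ℕ) :
    derivative (abelPoly x (n + 1)) = C ((n : ℚ) + 1) * abelPoly x n := by
  have hs : ∀ k ∈ Finset.range n, C (((n + 1).choose (k + 1) : ℚ) * x * (x + k + 1) ^ k) *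
      (C ((n + 1 - (k + 1) : ℕ) : ℚ) * (X - C ((k : ℚ) + 1)) ^ (n + 1 - (k + 1) - 1)) =
      C ((n : ℚ) + 1) * (C (n.choose (k + 1) * x * (x + k + 1) ^ k) *
        (X - C ((k : ℚ) + 1)) ^ (n - (k + 1))) := by
    intro k hk
    have hk' := Finset.mem_range.1 hk
    have h1 : ((n + 1).choose (k + 1) : ℚ) * ((n - k : ℕ) : ℚ) = (n + 1) * n.choose (k + 1) := by
      have := Nat.choose_mul_succ_eq n (k + 1)
      rw [show n + 1 - (k + 1) = n - k by omega] at this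
      exact_mod_cast (this.symm.trans (mul_comm _ _))
    have h2 : ((n + 1).choose (k + 1) : ℚ) * x * (x + k + 1) ^ k * ((n - k : ℕ) : ℚ) =
        ((n : ℚ) + 1) * (n.choose (k + 1) * x * (x + k + 1) ^ k) := by
      linear_combination x * (x + k + 1) ^ k * h1
    rw [show n + 1 - (k + 1) = n - k by omega, show n - k - 1 = n - (k + 1) by omega,
      ← mul_assoc, ← mul_assoc, ← C_mul, ← C_mul, h2]
  simp only [abelPoly, derivative_sub, derivative_add, derivative_sum, Finset.sum_range_succ _ n,
    Nat.sub_self]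
  simp only [derivative_mul, derivative_C, zero_mul, zero_add, derivative_pow,
    derivative_sub, derivative_add, derivative_X, sub_zero, add_zero, mul_one,
    pow_zero, mul_sub, mul_add, Finset.mul_sum]
  rw [Finset.sum_congr rfl hs, Nat.add_sub_cancel, Nat.cast_add, Nat.cast_one]

open Polynomial in
/-- For `y = -x`, Abel's identity says that a finite difference of order `n + 1` of the polynomial
`x ^ n` vanishes. -/
theorem eval_neg_abelPoly (x : ℚ) (n : ℕ) : (abelPoly x (n + 1)).eval (-x) = 0 := by
  have hdiff := congrFun (fwdDiff_iter_pow_eq_zero_of_lt (R := ℚ) (Nat.lt_succ_self n)) x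
  rw [fwdDiff_iter_eq_sum_shift, Finset.sum_range_succ'] at hdiff
  simp only [zsmul_eq_mul, nsmul_eq_mul, Pi.zero_apply] at hdiff
  push_cast at hdiff
  have : ∀ k ∈ Finset.range (n + 1), ((n + 1).choose (k + 1) : ℚ) * x * (x + k + 1) ^ k *
      (-x - (k + 1)) ^ (n + 1 - (k + 1)) =
      x * ((-1) ^ (n + 1 - (k + 1)) * (n + 1).choose (k + 1) * (x + (k + 1) * 1) ^ n) := by
    intro k hk
    have hk' := Finset.mem_range.1 hk
    have e1 : (-x - ((k : ℚ) + 1)) = (-1) * (x + k + 1) := by ring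
    have e2 : (x + ((k : ℚ) + 1) * 1) ^ n =
        (x + k + 1) ^ k * (x + k + 1) ^ (n + 1 - (k + 1)) := by
      rw [← pow_add, show k + (n + 1 - (k + 1)) = n by omega]
      ring
    rw [e1, mul_pow, e2]
    ring
  simp only [abelPoly, eval_sub, eval_add, eval_pow, eval_X, eval_finsetSum, eval_mul, eval_C,
    neg_add_cancel]
  rw [Finset.sum_congr rfl this, ← Finset.mul_sum, zero_pow (Nat.succ_ne_zero n), sub_zero,
    neg_pow, pow_succ x]
  simp only [Nat.choose_zero_right, Nat.cast_one, mul_one, add_zero,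
    Nat.succ_eq_add_one, Nat.add_sub_add_right] at hdiff ⊢
  linear_combination x * hdiff

open Polynomial in
/-- **Abel's binomial identity**. Both sides are polynomials in `y` whose derivatives agree by
induction, and that agree for `y = -x`. -/
theorem abel_identity (n : ℕ) (x y : ℚ) :
    y ^ n + ∑ k ∈ Finset.range n,
      n.choose (k + 1) * x * (x + k + 1) ^ k * (y - (k + 1)) ^ (n - (k + 1)) = (x + y) ^ n := by
  have hF : abelPoly x n = 0 := by
    induction n with
    | zero => simp [abelPoly]
    | succ n ih =>
      have hder := derivative_abelPoly x n
      rw [ih, mul_zero] at hder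
      have hconst := eq_C_of_derivative_eq_zero hder
      have heval := eval_neg_abelPoly x n
      rw [hconst, eval_C] at heval
      rw [hconst, heval, C_0]
  have := congrArg (eval y) hF
  simp only [abelPoly, eval_sub, eval_add, eval_pow, eval_X, eval_finsetSum, eval_mul, eval_C,
    eval_zero] at this
  rw [add_comm x y]
  linear_combination this

/-- The recursion for the number of members of `𝔅(A)`. -/
theorem sum_choose_lieBasis (n : ℕ) :
    n ^ n + ∑ k ∈ Finset.range n, n.choose (k + 1) * (k ^ k * (n - k) ^ (n - k - 1)) =
      (n + 1) ^ n := by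
  have := abel_identity n (-1) (n + 1)
  have h2 : ∑ k ∈ Finset.range n, (n.choose (k + 1) : ℚ) * -1 * (-1 + k + 1) ^ k *
      ((n : ℚ) + 1 - (k + 1)) ^ (n - (k + 1)) =
      -∑ k ∈ Finset.range n,
        (n.choose (k + 1) : ℚ) * (k ^ k * ((n - k : ℕ) : ℚ) ^ (n - k - 1)) := by
    rw [← Finset.sum_neg_distrib]
    refine Finset.sum_congr rfl fun k hk => ?_
    rw [Nat.cast_sub (Finset.mem_range.1 hk).le, Nat.sub_sub]
    ring
  rw [h2, show (-1 + ((n : ℚ) + 1)) = n by ring] at this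
  have h3 : ((n : ℚ)) ^ n + ∑ k ∈ Finset.range n,
      (n.choose (k + 1) : ℚ) * (k ^ k * ((n - k : ℕ) : ℚ) ^ (n - k - 1)) = ((n : ℚ) + 1) ^ n := by
    linarith
  exact_mod_cast h3

/-- The recursion for the number of products over partitions. -/
theorem sum_choose_partition (n : ℕ) :
    ∑ k ∈ Finset.range (n + 1), n.choose k * ((n + 1 - k) ^ (n - k) * (k + 1) ^ (k - 1)) =
      (n + 2) ^ n := by
  have := abel_identity n 1 (n + 1)
  have h2 : ∑ k ∈ Finset.range n, (n.choose (k + 1) : ℚ) * 1 * (1 + k + 1) ^ k *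
      ((n : ℚ) + 1 - (k + 1)) ^ (n - (k + 1)) =
      ∑ k ∈ Finset.range n, (n.choose (k + 1) : ℚ) *
        (((n + 1 - (k + 1) : ℕ) : ℚ) ^ (n - (k + 1)) * ((k + 1 : ℕ) + 1) ^ (k + 1 - 1)) := by
    refine Finset.sum_congr rfl fun k hk => ?_
    have := Finset.mem_range.1 hk
    rw [Nat.cast_sub (by omega)]
    push_cast
    ring
  rw [Finset.sum_range_succ']
  rw [h2, show (1 + ((n : ℚ) + 1)) = n + 2 by ring] at this
  have h3 : ((∑ k ∈ Finset.range n, n.choose (k + 1) *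
      ((n + 1 - (k + 1)) ^ (n - (k + 1)) * (k + 1 + 1) ^ (k + 1 - 1)) + (n + 1) ^ n : ℕ) : ℚ) =
      ((n + 2) ^ n : ℕ) := by
    push_cast at this ⊢
    linarith
  have h4 := Nat.cast_injective h3
  simpa using h4

end Abel

/-! ### The number of Lie monomials -/

section Counting

variable {I : Type*} [LinearOrder I]

open Classical in
/-- The members of `𝔅(A)`, and those among them that are single generators or first brackets, form
finite sets of cardinalities `m ^ (m - 1)` and `(m - 1) ^ (m - 1)`, where `m = |A|`. -/
theorem exists_finset_lieBasis (N : ℕ) : ∀ A : Finset I, A.card = N + 1 → ∃ F F' : Finset (Mon I),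
    (∀ b, b ∈ F ↔ LieBasis A b) ∧ (∀ b, b ∈ F' ↔ LieBasis A b ∧ b.IsBlock) ∧
      F.card = (N + 1) ^ N ∧ F'.card = N ^ N := by
  induction N using Nat.strong_induction_on with
  | _ N ih =>
  intro A hA
  have ih' : ∀ S : Finset I, ∃ F F' : Finset (Mon I), ∀ k < N, S.card = k + 1 →
      (∀ b, b ∈ F ↔ LieBasis S b) ∧ (∀ b, b ∈ F' ↔ LieBasis S b ∧ b.IsBlock) ∧
        F.card = (k + 1) ^ k ∧ F'.card = k ^ k := by
    intro S
    by_cases h : ∃ k < N, S.card = k + 1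
    · obtain ⟨k, hk, hS⟩ := h
      obtain ⟨F, F', hF⟩ := ih k hk S hS
      refine ⟨F, F', fun k' _ hS' => ?_⟩
      obtain rfl : k = k' := by omega
      exact hF
    · exact ⟨∅, ∅, fun k hk hS => absurd ⟨k, hk, hS⟩ h⟩
  choose F F' hF using ih'
  obtain ⟨m, hm⟩ : ∃ m, IsGreatest (A : Set I) m :=
    ⟨_, A.isGreatest_max' (Finset.card_pos.1 (by omega))⟩
  have hmA : m ∈ A := hm.1
  have hcm : (A.erase m).card = N := by rw [Finset.card_erase_of_mem hmA]; omega
  -- The blocks.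
  obtain ⟨B, hB, hBc⟩ : ∃ B : Finset (Mon I), (∀ b, b ∈ B ↔ LieBasis A b ∧ b.IsBlock) ∧
      B.card = N ^ N := by
    rcases Nat.eq_zero_or_pos N with rfl | hN
    · have hAm : A = {m} := by
        obtain ⟨a, rfl⟩ := Finset.card_eq_one.1 hA
        rw [Finset.mem_singleton.1 hmA]
      refine ⟨{.gen m}, fun b => ?_, by simp⟩
      rw [Finset.mem_singleton]
      constructor
      · rintro rfl
        exact ⟨hAm ▸ .gen m, .inl ⟨m, rfl⟩⟩
      · rintro ⟨hb, ⟨i, rfl⟩ | ⟨s, t, rfl⟩⟩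
        · have := hb.supp_eq
          rw [hAm] at this
          rw [Finset.singleton_injective this]
        · obtain ⟨i, rfl, hi, -, ht⟩ := hb.inv_br₁
          have := ht.supp_eq ▸ t.first_mem
          rw [hAm] at this hi
          simp_all
    · refine ⟨(A.erase m).biUnion fun i => (F (A.erase i)).image (Mon.br₁ (.gen i)), fun b => ?_,
        ?_⟩
      · simp only [Finset.mem_biUnion, Finset.mem_image]
        constructor
        · rintro ⟨i, hi, t, ht, rfl⟩
          obtain ⟨hi1, hi2⟩ := Finset.mem_erase.1 hi
          rw [(hF (A.erase i) (N - 1) (by omega)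
            (by rw [Finset.card_erase_of_mem hi2]; omega)).1] at ht
          exact ⟨.br₁ hm hi2 (lt_of_le_of_ne (hm.2 hi2) hi1) ht, .inr ⟨_, _, rfl⟩⟩
        · rintro ⟨hb, ⟨i, rfl⟩ | ⟨s, t, rfl⟩⟩
          · have := hb.supp_eq
            rw [← this] at hA
            simp only [Mon.supp, Finset.card_singleton] at hA
            omega
          · have htip : t.tip = m := hb.isGreatest_tip.unique hm
            obtain ⟨i, rfl, hi, hit, ht⟩ := hb.inv_br₁
            refine ⟨i, Finset.mem_erase.2 ⟨?_, hi⟩, t, ?_, rfl⟩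
            · rw [← htip]; exact hit.ne
            · rwa [(hF (A.erase i) (N - 1) (by omega)
                (by rw [Finset.card_erase_of_mem hi]; omega)).1]
      · rw [Finset.card_biUnion]
        · have : ∀ i ∈ A.erase m, ((F (A.erase i)).image (Mon.br₁ (.gen i))).card =
              N ^ (N - 1) := by
            intro i hi
            obtain ⟨hi1, hi2⟩ := Finset.mem_erase.1 hi
            rw [Finset.card_image_of_injective _ (fun x y h => by simpa using h),
              (hF (A.erase i) (N - 1) (by omega)
              (by rw [Finset.card_erase_of_mem hi2]; omega)).2.2.1, Nat.sub_add_cancel hN]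
          rw [Finset.sum_congr rfl this, Finset.sum_const, hcm, smul_eq_mul, ← pow_succ',
            Nat.sub_add_cancel hN]
        · intro i _ j _ hij
          refine Finset.disjoint_left.2 fun b hb hb' => ?_
          obtain ⟨t, -, rfl⟩ := Finset.mem_image.1 hb
          obtain ⟨t', -, h⟩ := Finset.mem_image.1 hb'
          simp only [Mon.br₁.injEq, Mon.gen.injEq] at h
          exact hij h.1.symm
  -- The second brackets.
  let D := ((A.erase m).powerset.filter Finset.Nonempty).biUnion fun S =>
    ((F' S) ×ˢ (F (A \ S))).image fun p => Mon.br₂ p.1 p.2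
  have hS : ∀ S ∈ (A.erase m).powerset.filter Finset.Nonempty, S ⊆ A ∧ m ∉ S ∧
      ∃ k < N, S.card = k + 1 ∧ N - k - 1 < N ∧ (A \ S).card = (N - k - 1) + 1 := by
    intro S hS
    obtain ⟨h1, h2⟩ := Finset.mem_filter.1 hS
    have h3 := Finset.mem_powerset.1 h1
    have h4 := Finset.card_le_card h3
    have h5 := h2.card_pos
    have h6 : S ⊆ A := h3.trans (Finset.erase_subset _ _)
    refine ⟨h6, fun h => (Finset.mem_erase.1 (h3 h)).1 rfl, S.card - 1, by omega, by omega,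
      by omega, ?_⟩
    rw [Finset.card_sdiff_of_subset h6]
    omega
  have hD : ∀ b, b ∈ D ↔ ∃ s t, b = .br₂ s t ∧ LieBasis A b := by
    intro b
    simp only [D, Finset.mem_biUnion, Finset.mem_image, Finset.mem_product, Prod.exists]
    constructor
    · rintro ⟨S, hSm, s, t, ⟨hs, ht⟩, rfl⟩
      obtain ⟨h1, h2, k, hk, hk', hl, hl'⟩ := hS S hSm
      rw [(hF S k hk hk').2.1] at hs
      rw [(hF _ _ hl hl').1] at ht
      exact ⟨s, t, rfl, .br₂ Finset.disjoint_sdiff (Finset.union_sdiff_of_subset h1) hm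
        (Finset.mem_sdiff.2 ⟨hmA, h2⟩) hs.1 ht hs.2⟩
    · rintro ⟨s, t, rfl, hb⟩
      have htip : t.tip = m := hb.isGreatest_tip.unique hm
      obtain ⟨h1, h2, h3, h4, h5⟩ := hb.inv_br₂
      have hms : m ∉ s.supp := fun h => Finset.disjoint_left.1 h1 h (htip ▸ t.tip_mem)
      have hSm : s.supp ∈ (A.erase m).powerset.filter Finset.Nonempty := by
        refine Finset.mem_filter.2 ⟨Finset.mem_powerset.2 fun x hx => Finset.mem_erase.2
          ⟨?_, h2 ▸ Finset.mem_union_left _ hx⟩, ⟨_, s.first_mem⟩⟩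
        rintro rfl
        exact hms hx
      have ht : A \ s.supp = t.supp := by
        rw [← h2, Finset.union_sdiff_cancel_left h1]
      obtain ⟨-, -, k, hk, hk', hl, hl'⟩ := hS _ hSm
      refine ⟨s.supp, hSm, s, t, ⟨?_, ?_⟩, rfl⟩
      · rw [(hF _ k hk hk').2.1]
        exact ⟨h3, h5⟩
      · rw [(hF _ _ hl hl').1, ht]
        exact h4
  have hDc : D.card = ∑ k ∈ Finset.range N,
      N.choose (k + 1) * (k ^ k * (N - k) ^ (N - k - 1)) := by
    rw [Finset.card_biUnion]
    · have : ∀ S ∈ (A.erase m).powerset.filter Finset.Nonempty,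
          (((F' S) ×ˢ (F (A \ S))).image fun p => Mon.br₂ p.1 p.2).card =
          (S.card - 1) ^ (S.card - 1) * (N - (S.card - 1)) ^ (N - (S.card - 1) - 1) := by
        intro S hSm
        obtain ⟨-, -, k, hk, hk', hl, hl'⟩ := hS S hSm
        rw [Finset.card_image_of_injective _ (fun x y h => by
          simp only [Mon.br₂.injEq] at h; exact Prod.ext h.1 h.2), Finset.card_product,
          (hF S k hk hk').2.2.2, (hF _ _ hl hl').2.2.1, hk', Nat.add_sub_cancel,
          show N - k - 1 + 1 = N - k by omega]
      rw [Finset.sum_congr rfl this, Finset.sum_filter]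
      have : ∀ S ∈ (A.erase m).powerset, (if S.Nonempty then (S.card - 1) ^ (S.card - 1) *
          (N - (S.card - 1)) ^ (N - (S.card - 1) - 1) else 0) =
          (fun k => if k = 0 then 0 else (k - 1) ^ (k - 1) *
            (N - (k - 1)) ^ (N - (k - 1) - 1)) S.card := by
        intro S _
        by_cases h : S = ∅
        · simp [h]
        · simp [h, Finset.nonempty_iff_ne_empty]
      rw [Finset.sum_congr rfl this, Finset.sum_powerset_apply_card (fun k => if k = 0 then 0 else
        (k - 1) ^ (k - 1) * (N - (k - 1)) ^ (N - (k - 1) - 1)), hcm, Finset.sum_range_succ']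
      simp
    · intro S hSm S' hSm' hSS'
      refine Finset.disjoint_left.2 fun b hb hb' => ?_
      obtain ⟨⟨s, t⟩, hst, rfl⟩ := Finset.mem_image.1 hb
      obtain ⟨⟨s', t'⟩, hst', h⟩ := Finset.mem_image.1 hb'
      simp only [Mon.br₂.injEq] at h
      obtain ⟨-, -, k, hk, hk', -⟩ := hS S hSm
      obtain ⟨-, -, l, hl, hl', -⟩ := hS S' hSm'
      have h1 := ((hF S k hk hk').2.1 s).1 (Finset.mem_product.1 hst).1
      have h2 := ((hF S' l hl hl').2.1 s').1 (Finset.mem_product.1 hst').1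
      exact hSS' (by rw [← h1.1.supp_eq, ← h2.1.supp_eq, h.1])
  refine ⟨B ∪ D, B, fun b => ?_, hB, ?_, hBc⟩
  · rw [Finset.mem_union, hB, hD]
    constructor
    · rintro (h | ⟨s, t, -, h⟩)
      · exact h.1
      · exact h
    · intro h
      cases b with
      | gen i => exact .inl ⟨h, .inl ⟨i, rfl⟩⟩
      | br₁ s t => exact .inl ⟨h, .inr ⟨s, t, rfl⟩⟩
      | br₂ s t => exact .inr ⟨s, t, rfl, h⟩
      | star s t => cases h
  · rw [Finset.card_union_of_disjoint, hBc, hDc, sum_choose_lieBasis]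
    refine Finset.disjoint_left.2 fun b hb hb' => ?_
    obtain ⟨s, t, rfl, -⟩ := (hD b).1 hb'
    rcases ((hB _).1 hb).2 with ⟨i, h⟩ | ⟨s, t, h⟩ <;> cases h

end Counting

/-! ### The number of products over partitions -/

section Partitions

variable {I : Type*} [LinearOrder I]

/-- Inversion of the constructor `IsPartitionList.cons`. -/
theorem IsPartitionList.inv_cons {A : Finset I} {c : Mon I} {l : List (Mon I)}
    (h : IsPartitionList A (c :: l)) : csupp l ⊆ A ∧ Disjoint (csupp l) c.supp ∧
      csupp l ∪ c.supp = A ∧ IsGreatest (A : Set I) c.tip ∧ LieBasis c.supp c ∧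
        IsPartitionList (csupp l) l := by
  cases h with
  | cons hd hu hm hmA hc hl =>
    have h1 := hc.supp_eq
    have h2 := hl.csupp_eq
    subst h1 h2
    have : c.tip = _ := hc.isGreatest_tip.unique
      ⟨hmA, fun x hx => hm.2 (by rw [← hu]; exact Finset.mem_union_right _ hx)⟩
    exact ⟨hu ▸ Finset.subset_union_left, hd, hu, this ▸ hm, hc, hl⟩

open Classical in
/-- The lists over partitions of an `N`-element set form a finite set of cardinality
`(N + 1) ^ (N - 1)`. The summands of the recursion are indexed by the union of all blocks but the
one that contains the maximum. -/
theorem exists_finset_isPartitionList (N : ℕ) : ∀ A : Finset I, A.card = N →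
    ∃ T : Finset (List (Mon I)), (∀ l, l ∈ T ↔ IsPartitionList A l) ∧
      T.card = (N + 1) ^ (N - 1) := by
  induction N using Nat.strong_induction_on with
  | _ N ih =>
  intro A hA
  obtain _ | N := N
  · obtain rfl := Finset.card_eq_zero.1 hA
    refine ⟨{[]}, fun l => ?_, by simp⟩
    rw [Finset.mem_singleton]
    constructor
    · rintro rfl
      exact .nil
    · intro h
      cases l with
      | nil => rfl
      | cons c l => exact absurd h.inv_cons.2.2.2.1.1 (by simp)
  have ih' : ∀ S : Finset I, ∃ T : Finset (List (Mon I)), S.card ≤ N →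
      (∀ l, l ∈ T ↔ IsPartitionList S l) ∧ T.card = (S.card + 1) ^ (S.card - 1) := by
    intro S
    by_cases h : S.card ≤ N
    · obtain ⟨T, hT⟩ := ih _ (Nat.lt_succ_of_le h) S rfl
      exact ⟨T, fun _ => hT⟩
    · exact ⟨∅, fun h' => absurd h' h⟩
  have ihF : ∀ S : Finset I, ∃ F : Finset (Mon I), S.Nonempty →
      (∀ b, b ∈ F ↔ LieBasis S b) ∧ F.card = S.card ^ (S.card - 1) := by
    intro S
    by_cases h : S.Nonempty
    · obtain ⟨F, -, h1, -, h2, -⟩ := exists_finset_lieBasis (S.card - 1) S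
        (Nat.sub_add_cancel h.card_pos).symm
      rw [Nat.sub_add_cancel h.card_pos] at h2
      exact ⟨F, fun _ => ⟨h1, h2⟩⟩
    · exact ⟨∅, fun h' => absurd h' h⟩
  choose T hT using ih'
  choose F hF using ihF
  obtain ⟨m, hm⟩ : ∃ m, IsGreatest (A : Set I) m :=
    ⟨_, A.isGreatest_max' (Finset.card_pos.1 (by omega))⟩
  have hmA : m ∈ A := hm.1
  have hcm : (A.erase m).card = N := by rw [Finset.card_erase_of_mem hmA]; omega
  have hS : ∀ S ∈ (A.erase m).powerset, S ⊆ A ∧ S.card ≤ N ∧ m ∈ A \ S ∧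
      (A \ S).card = N + 1 - S.card := by
    intro S hS
    have h3 := Finset.mem_powerset.1 hS
    have h4 := Finset.card_le_card h3
    have h6 : S ⊆ A := h3.trans (Finset.erase_subset _ _)
    refine ⟨h6, by omega, Finset.mem_sdiff.2 ⟨hmA, fun h => (Finset.mem_erase.1 (h3 h)).1 rfl⟩, ?_⟩
    rw [Finset.card_sdiff_of_subset h6]
    omega
  refine ⟨(A.erase m).powerset.biUnion fun S =>
    ((F (A \ S)) ×ˢ (T S)).image fun p => p.1 :: p.2, fun l => ?_, ?_⟩
  · simp only [Finset.mem_biUnion, Finset.mem_image, Finset.mem_product, Prod.exists]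
    constructor
    · rintro ⟨S, hSm, c, l, ⟨hc, hl⟩, rfl⟩
      obtain ⟨h1, h2, h3, h4⟩ := hS S hSm
      rw [(hF _ ⟨m, h3⟩).1] at hc
      rw [(hT _ h2).1] at hl
      exact .cons Finset.disjoint_sdiff (Finset.union_sdiff_of_subset h1) hm h3 hc hl
    · intro h
      cases l with
      | nil =>
        have := h.csupp_eq
        rw [← this] at hmA
        simp [csupp] at hmA
      | cons c l =>
        obtain ⟨h1, h2, h3, h4, h5, h6⟩ := h.inv_cons
        have htip : c.tip = m := h4.unique hm
        have hml : m ∉ csupp l := fun h => Finset.disjoint_left.1 h2 h (htip ▸ c.tip_mem)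
        have hSm : csupp l ∈ (A.erase m).powerset := by
          refine Finset.mem_powerset.2 fun x hx => Finset.mem_erase.2 ⟨?_, h1 hx⟩
          rintro rfl
          exact hml hx
        have hc : A \ csupp l = c.supp := by rw [← h3, Finset.union_sdiff_cancel_left h2]
        obtain ⟨-, h7, h8, -⟩ := hS _ hSm
        refine ⟨csupp l, hSm, c, l, ⟨?_, ?_⟩, rfl⟩
        · rwa [(hF _ ⟨m, h8⟩).1, hc]
        · rwa [(hT _ h7).1]
  · rw [Finset.card_biUnion]
    · have : ∀ S ∈ (A.erase m).powerset, (((F (A \ S)) ×ˢ (T S)).image fun p => p.1 :: p.2).card =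
          (N + 1 - S.card) ^ (N - S.card) * (S.card + 1) ^ (S.card - 1) := by
        intro S hSm
        obtain ⟨h1, h2, h3, h4⟩ := hS S hSm
        rw [Finset.card_image_of_injective _ (fun x y h => by
          simp only [List.cons.injEq] at h; exact Prod.ext h.1 h.2), Finset.card_product,
          (hF _ ⟨m, h3⟩).2, (hT S h2).2, h4, show N + 1 - S.card - 1 = N - S.card by omega]
      rw [Finset.sum_congr rfl this, Finset.sum_powerset_apply_card (fun k =>
        (N + 1 - k) ^ (N - k) * (k + 1) ^ (k - 1)), hcm]
      simpa using sum_choose_partition N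
    · intro S hSm S' hSm' hSS'
      refine Finset.disjoint_left.2 fun b hb hb' => ?_
      obtain ⟨⟨s, t⟩, hst, rfl⟩ := Finset.mem_image.1 hb
      obtain ⟨⟨s', t'⟩, hst', h⟩ := Finset.mem_image.1 hb'
      simp only [List.cons.injEq] at h
      have h1 := ((hT S (hS S hSm).2.1).1 t).1 (Finset.mem_product.1 hst).2
      have h2 := ((hT S' (hS S' hSm').2.1).1 t').1 (Finset.mem_product.1 hst').2
      exact hSS' (by rw [← h1.csupp_eq, ← h2.csupp_eq, h.2])

/-- The factors of a right-nested product. -/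
def Mon.factors : Mon I → List (Mon I)
  | .star s t => s :: t.factors
  | b => [b]

theorem Mon.factors_starList (c : Mon I) (l : List (Mon I)) :
    (starList c l).factors = l.reverse ++ c.factors := by
  induction l generalizing c with
  | nil => simp [starList]
  | cons d l ih => rw [starList, ih, Mon.factors, List.reverse_cons, List.append_assoc]; rfl

theorem LieBasis.factors_eq {A : Finset I} {b : Mon I} (h : LieBasis A b) : b.factors = [b] := by
  cases h <;> rfl

/-- A product over a partition determines the list of its factors, since Lie monomials are not
products. -/
theorem ncard_partitionMonomials (A : Finset I) (hA : A.Nonempty) :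
    (partitionMonomials A).ncard = (A.card + 1) ^ (A.card - 1) := by
  obtain ⟨T, hT, hTc⟩ := exists_finset_isPartitionList A.card A rfl
  have : Set.BijOn (fun b : Mon I => b.factors.reverse) (partitionMonomials A)
      (T : Set (List (Mon I))) := by
    have key : ∀ c l, IsPartitionList A (c :: l) → (starList c l).factors.reverse = c :: l := by
      intro c l h
      rw [Mon.factors_starList, h.inv_cons.2.2.2.2.1.factors_eq]
      simp
    refine ⟨?_, ?_, ?_⟩
    · rintro _ ⟨c, l, h, rfl⟩
      simp only [Finset.mem_coe, hT, key c l h, h]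
    · rintro _ ⟨c, l, h, rfl⟩ _ ⟨c', l', h', rfl⟩ heq
      simp only [key c l h, key c' l' h', List.cons.injEq] at heq
      rw [heq.1, heq.2]
    · intro l hl
      have hl := (hT l).1 hl
      cases l with
      | nil => rw [← hl.csupp_eq] at hA; simp [csupp] at hA
      | cons c l => exact ⟨_, ⟨c, l, hl, rfl⟩, key c l hl⟩
  rw [this.ncard_eq, Set.ncard_coe_finset, hTc]

theorem starList_concat (c : Mon I) (l : List (Mon I)) (e : Mon I) :
    starList c (l ++ [e]) = .star e (starList c l) := by
  induction l generalizing c with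
  | nil => rfl
  | cons d l ih => rw [List.cons_append, starList, ih, starList]

/-- `starProd` takes its factors from left to right, `starList` takes them from right to left. -/
theorem starProd_eq_starList {k : ℕ} (c : Fin (k + 1) → Mon I) :
    ∃ d l, (List.ofFn c).reverse = d :: l ∧ starProd c = starList d l := by
  induction k with
  | zero => exact ⟨c 0, [], by simp, rfl⟩
  | succ k ih =>
    obtain ⟨d, l, h1, h2⟩ := ih (Fin.tail c)
    refine ⟨d, l ++ [c 0], ?_, ?_⟩
    · rw [List.ofFn_succ, List.reverse_cons, ← List.cons_append, ← h1]
      rfl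
    · rw [starProd, h2, starList_concat]

/-- The lists over partitions, described through the indexed families of their blocks. -/
theorem isPartitionList_ofFn {k : ℕ} (A : Fin k → Finset I) (c : Fin k → Mon I)
    (hd : Pairwise fun i j => Disjoint (A i) (A j)) (hmax : Monotone fun j => (A j).max)
    (hc : ∀ j, LieBasis (A j) (c j)) :
    IsPartitionList (Finset.univ.biUnion A) (List.ofFn c).reverse := by
  induction k with
  | zero => simpa using IsPartitionList.nil
  | succ k ih =>
    have ih := ih (fun j => A j.castSucc) (fun j => c j.castSucc)
      (fun i j hij => hd fun h => hij (Fin.castSucc_injective k h))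
      (fun i j hij => hmax (by simpa using hij)) (fun j => hc _)
    rw [List.ofFn_succ', List.concat_eq_append, List.reverse_append, List.reverse_singleton,
      List.singleton_append]
    have hg := (hc (Fin.last k)).isGreatest_tip
    refine .cons (A₁ := Finset.univ.biUnion fun j : Fin k => A j.castSucc) (A₂ := A (Fin.last k))
      (m := (c (Fin.last k)).tip) ?_ ?_ ⟨?_, ?_⟩ hg.1 (hc _) ih
    · rw [Finset.disjoint_biUnion_left]
      exact fun j _ => hd (Fin.castSucc_lt_last j).ne
    · ext x
      simp only [Finset.mem_union, Finset.mem_biUnion, Finset.mem_univ, true_and]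
      constructor
      · rintro (⟨j, hj⟩ | h)
        exacts [⟨_, hj⟩, ⟨_, h⟩]
      · rintro ⟨j, hj⟩
        induction j using Fin.lastCases with
        | last => exact .inr hj
        | cast j => exact .inl ⟨j, hj⟩
    · exact Finset.mem_coe.2 (Finset.mem_biUnion.2 ⟨_, Finset.mem_univ _, hg.1⟩)
    · intro x hx
      obtain ⟨j, -, hj⟩ := Finset.mem_biUnion.1 (Finset.mem_coe.1 hx)
      have h1 := (Finset.le_max hj).trans (hmax (Fin.le_last j))
      have h2 : (A (Fin.last k)).max ≤ ((c (Fin.last k)).tip : WithBot I) :=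
        Finset.max_le fun a ha => WithBot.coe_le_coe.2 (hg.2 ha)
      exact WithBot.coe_le_coe.1 (h1.trans h2)

theorem IsPartitionList.pairwise {A : Finset I} {l : List (Mon I)} (h : IsPartitionList A l) :
    (∀ c ∈ l, LieBasis c.supp c) ∧
      l.Pairwise fun c d => Disjoint c.supp d.supp ∧ d.supp.max ≤ c.supp.max := by
  induction l generalizing A with
  | nil => simp
  | cons c l ih =>
    obtain ⟨h1, h2, h3, h4, h5, h6⟩ := h.inv_cons
    obtain ⟨ih1, ih2⟩ := ih h6
    have hsub : ∀ d ∈ l, d.supp ⊆ csupp l := by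
      intro d hd
      clear * - hd
      induction l with
      | nil => simp at hd
      | cons e l ih =>
        rcases List.mem_cons.1 hd with rfl | hd
        · exact Finset.subset_union_left
        · exact (ih hd).trans Finset.subset_union_right
    refine ⟨List.forall_mem_cons.2 ⟨h5, ih1⟩, List.pairwise_cons.2 ⟨fun d hd =>
      ⟨h2.symm.mono_right (hsub d hd), ?_⟩, ih2⟩⟩
    exact Finset.max_le fun a ha => (WithBot.coe_le_coe.2 (h4.2 (h1 (hsub d hd ha)))).trans
      (Finset.le_max c.tip_mem)

/-- The converse of `isPartitionList_ofFn`. -/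
theorem IsPartitionList.exists_ofFn {A : Finset I} {l : List (Mon I)} (h : IsPartitionList A l) :
    ∃ c : Fin l.length → Mon I, (List.ofFn c).reverse = l ∧
      Pairwise (fun i j => Disjoint (c i).supp (c j).supp) ∧
      Finset.univ.biUnion (fun j => (c j).supp) = A ∧ Monotone (fun j => (c j).supp.max) ∧
      ∀ j, LieBasis (c j).supp (c j) := by
  obtain ⟨h1, h2⟩ := h.pairwise
  let c : Fin l.length → Mon I := fun i => l.get i.rev
  have hc : (List.ofFn c).reverse = l := by
    refine List.ext_get (by simp) fun i hi hi' => ?_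
    simp only [List.get_eq_getElem, List.getElem_reverse, List.getElem_ofFn, c, Fin.val_rev,
      List.length_ofFn]
    congr 1
    omega
  have hlt : ∀ i j, i < j → Disjoint (c i).supp (c j).supp ∧ (c i).supp.max ≤ (c j).supp.max := by
    intro i j hij
    have := List.pairwise_iff_get.1 h2 j.rev i.rev (Fin.rev_lt_rev.2 hij)
    exact ⟨this.1.symm, this.2⟩
  have hL : ∀ j, LieBasis (c j).supp (c j) := fun j => h1 _ (List.get_mem _ _)
  have hd : Pairwise (fun i j => Disjoint (c i).supp (c j).supp) := by
    intro i j hij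
    rcases lt_or_gt_of_ne hij with h | h
    exacts [(hlt i j h).1, (hlt j i h).1.symm]
  have hm : Monotone (fun j => (c j).supp.max) := by
    intro i j hij
    rcases hij.eq_or_lt with rfl | h
    exacts [le_rfl, (hlt i j h).2]
  refine ⟨c, hc, hd, ?_, hm, hL⟩
  have := isPartitionList_ofFn _ c hd hm hL
  rw [hc] at this
  rw [← this.csupp_eq, h.csupp_eq]

end Partitions

theorem P₂Basis_eq (n : ℕ) : P₂Basis n = partitionMonomials (Finset.univ : Finset (Fin n)) := by
  ext b
  constructor
  · rintro ⟨k, A, c, hd, hu, hm, hc, rfl⟩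
    obtain ⟨d, l, h1, h2⟩ := starProd_eq_starList c
    have := isPartitionList_ofFn A c hd hm hc
    rw [h1, hu] at this
    exact ⟨d, l, this, h2⟩
  · rintro ⟨d, l, h, rfl⟩
    obtain ⟨c, h1, h2, h3, h4, h5⟩ := h.exists_ofFn
    refine ⟨l.length, _, c, h2, h3, h4, h5, ?_⟩
    obtain ⟨d', l', h1', h2'⟩ := starProd_eq_starList (k := l.length) c
    obtain ⟨rfl, rfl⟩ := List.cons.inj (h1'.symm.trans h1)
    exact h2'.symm

end BiHam

theorem mainTheorem3 (n : ℕ) (hn : 1 ≤ n) :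
    (∃ B : Module.Basis (BiHam.P₂Basis n) ℚ (BiHam.P₂ (Fin n)),
      ∀ b : BiHam.P₂Basis n, ((B b : BiHam.P₂ (Fin n)) : BiHam.FreeBiHam (Fin n)) = b.1.eval) ∧
    Module.finrank ℚ (BiHam.P₂ (Fin n)) = (n + 1) ^ (n - 1) := by
  have hspan : Submodule.span ℚ (Set.range fun b : BiHam.P₂Basis n => b.1.eval) =
      BiHam.P₂ (Fin n) := by
    rw [BiHam.P₂_eq_span, ← BiHam.P₂Basis_eq, Set.image_eq_range]
  have hli : LinearIndependent ℚ fun b : BiHam.P₂Basis n => b.1.eval := by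
    rw [BiHam.P₂Basis_eq]
    exact BiHam.linearIndependent_partitionMonomials _
  have hB : ∃ B : Module.Basis (BiHam.P₂Basis n) ℚ (BiHam.P₂ (Fin n)), ∀ b : BiHam.P₂Basis n,
      ((B b : BiHam.P₂ (Fin n)) : BiHam.FreeBiHam (Fin n)) = b.1.eval := by
    rw [← hspan]
    exact ⟨.span hli, fun b => congrArg Subtype.val (Module.Basis.span_apply hli b)⟩
  refine ⟨hB, ?_⟩
  obtain ⟨B, -⟩ := hB
  have : NeZero n := ⟨by omega⟩
  rw [Module.finrank_eq_nat_card_basis B, Nat.card_coe_set_eq, BiHam.P₂Basis_eq,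
    BiHam.ncard_partitionMonomials _ Finset.univ_nonempty, Finset.card_univ, Fintype.card_fin]
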